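/- For $t\in\mathbb R$ let $\mathrm{sgn}_t(a)=1$ if $a\ge t$ and $\mathrm{sgn}_t(a)=0$ if $a<t$. Consider a network $f(x)=P(X_1,\dots,X_d)$ on $x\in\mathbb R^n$, where $X_i=\mathrm{sgn}_t\big((w_i^*)^{T}x\big)$, the vectors $w_1^*,\dots,w_d^*\in\mathbb R^n$ are orthonormal (they are the rows of a matrix $W^*\in\mathbb R^{d\times n}$), and $P$ is a real polynomial of degree at most $1$ in each variable. The learner receives $m$ independent noiseless samples $(x,f(x))$ with $x\sim\mathcal N(0,I_n)$; it knows $t$ and the parameters below, but neither $W^*$ nor $P$. For every constant $c>0$ there is a constant $C>0$, depending only on $c$, such that the following holds for all $d,n,m\in\mathbb N$, $t\in\mathbb R$, $\epsilon_2,\epsilon_3\in(0,1]$ and $\delta\in(0,1)$ with $n\le c\,d^{c}$, with $\frac1{\sqrt{2\pi}}e^{-t^2/2}\ge \frac{1}{c\,d^{c}}$, and with $$m\;\ge\; C\Big(\frac{d}{\epsilon_3\epsilon_2}\Big)^{C}\log\frac2\delta .$$ There is a (measurable) learner $L:(\mathbb R^n\times\mathbb R)^m\to\mathbb R^{d\times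 n}$ such that, for all $W^*$ and $P$ as above for which * $|P(v)|\le c\,d^{c}$ for all $v\in\{0,1\}^d$, and * for every $i$, the coefficient of the linear monomial $X_i$ in $P(\mu(X_1+1),\dots,\mu(X_d+1))$ is larger than $\epsilon_3\,\mu$, where $\mu=\mathbb E[X_i]$ (the same number for all $i$), with probability at least $1-\delta$ over the sample, the output of $L$ agrees with $W^*$ within error $\epsilon_2$ in each entry, up to a permutation of the rows. In particular, for fixed confidence, $\mathrm{poly}\big(\frac{d}{\epsilon_3\epsilon_2}\big)$ samples suffice to determine $W^*$ within $\epsilon_2$ in each entry. -/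

import Mathlib

open MeasureTheory ProbabilityTheory

noncomputable section

/-- The sign activation with threshold `t`: `1` for inputs at least `t`, and `0` below `t`. -/
def sgnAct (t a : ℝ) : ℝ := if t ≤ a then 1 else 0

/-- The outputs `X_i = sgnAct t (w_i · x)` of the lowest layer with weight vectors `w_i`. -/
def hiddenLayer {d n : ℕ} (t : ℝ) (w : Fin d → EuclideanSpace ℝ (Fin n))
    (x : EuclideanSpace ℝ (Fin n)) : Fin d → ℝ :=
  fun i => sgnAct t (inner ℝ (w i) x)

/-- The network `f(x) = P(X_1, …, X_d)`. -/
def network {d n : ℕ} (P : MvPolynomial (Fin d) ℝ) (t : ℝ)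
    (w : Fin d → EuclideanSpace ℝ (Fin n)) (x : EuclideanSpace ℝ (Fin n)) : ℝ :=
  MvPolynomial.eval (hiddenLayer t w x) P

/-- The polynomial `P(μ (X_1 + 1), …, μ (X_d + 1))`. -/
def shiftScale {d : ℕ} (μ : ℝ) (P : MvPolynomial (Fin d) ℝ) : MvPolynomial (Fin d) ℝ :=
  MvPolynomial.bind₁ (fun i => MvPolynomial.C μ * (MvPolynomial.X i + 1)) P

/-- The noiseless labelled sample `(x_1, f(x_1)), …, (x_m, f(x_m))` at the inputs `x_k = ω k`. -/
def labelledSample {d n m : ℕ} (P : MvPolynomial (Fin d) ℝ) (t : ℝ)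
    (w : Fin d → EuclideanSpace ℝ (Fin n)) (ω : Fin m → EuclideanSpace ℝ (Fin n)) :
    Fin m → EuclideanSpace ℝ (Fin n) × ℝ :=
  fun k => (ω k, network P t w (ω k))

/-- The matrix with rows `v_i` agrees with the matrix with rows `w_i` within `ε` in each entry,
up to the order of the rows (the hidden units carry no intrinsic labelling). -/
def EntrywiseClose {d n : ℕ} (ε : ℝ) (v w : Fin d → EuclideanSpace ℝ (Fin n)) : Prop :=
  ∃ σ : Equiv.Perm (Fin d), ∀ i j, |v (σ i) j - w i j| ≤ ε

end

/-!
The learner needs no computational efficiency, so it may test every direction `u` of a fine net of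
the unit sphere and keep those that behave like a weight vector.

The test detects a discontinuity.  Across the hyperplane `⟨w j, x⟩ = t` the network jumps by
`P(…, 1, …) - P(…, 0, …)` (with the `j`-th argument displayed), and because the hidden units are
independent, the mean of this jump is the coefficient of the linear monomial `X_j` in
`P(μ(X_1 + 1), …)` divided by `μ` (`mul_integral_jump`), hence larger than `ε₃`.  Let `S(u)` be the
correlation of the network with an odd bump of width `h` around `t`, evaluated at `⟨u, x⟩`.

* For `u = w j` only the half of the bump beyond the threshold contributes, and `S(u)` is of order
  `ε₃ h φ(t)`, with `φ` the Gaussian density (`le_correlation_thresholdBump`).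
* If `u` makes an intermediate angle with some `w j`, condition on all coordinates but the one
  along `w j`.  Unless the threshold of the `j`-th unit falls into the bump, the two halves of the
  bump cancel to second order in `h`; and that event has probability `O(h)`, while it costs only
  `O(h)`.  So `S(u) = O(h²)` (`abs_correlation_thresholdBump_le_of_inner`).
* If `u` is almost orthogonal to all the `w j`, the same cancellation takes place along the
  component of `u` orthogonal to the weights, on which the network does not depend
  (`abs_correlation_thresholdBump_le_of_sum`).

For small `h` a large `S(u)` therefore forces `u` to be close to some `w j` or `-w j`.  The
negatives have to be excluded separately, since for `t = 0` the network also jumps in the direction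
`-w j`.  This is done by the correlation with the odd function `z exp(-z²/2)`, which is
positive at `w j` (`le_correlation_oddWeight`) and changes sign with the direction.

Both correlations are Lipschitz in `u`, so a net of mesh polynomially small in the parameters
suffices (`exists_sphere_net`).  The logarithm of its cardinality is polynomial, so by Hoeffding's
inequality and a union bound polynomially many samples estimate all the correlations at once
(`one_sub_le_measureReal_empirical`).  Accepted directions with pairwise distances at least `1` then
correspond one to one to the weight vectors (`IsSeparatedFamily.entrywiseClose`).

All Gaussian computations rest on one fact: a coordinate of a standard Gaussian vector along a unit
vector may be resampled independently without changing the law (`map_resample_stdGaussian`).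
-/

/-! ### Resampling one coordinate of a Gaussian vector -/

section Resample

variable {E : Type*} [NormedAddCommGroup E] [InnerProductSpace ℝ E]

/-- The vector `x` with its component along the unit vector `e` replaced by `z`. -/
def resample (e : E) (z : ℝ) (x : E) : E := z • e + (x - inner ℝ e x • e)

lemma inner_resample (v e : E) (z : ℝ) (x : E) :
    inner ℝ v (resample e z x) = z * inner ℝ v e + inner ℝ (v - (inner ℝ v e : ℝ) • e) x := by
  simp only [resample, inner_add_right, inner_sub_right, inner_sub_left, inner_smul_right,
    real_inner_smul_left]
  ring

variable [FiniteDimensional ℝ E] [MeasurableSpace E] [BorelSpace E]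

lemma measurable_resample (e : E) : Measurable fun p : ℝ × E => resample e p.1 p.2 := by
  unfold resample; fun_prop

/-- Replacing one coordinate of a standard Gaussian vector by an independent standard Gaussian
does not change the law: both sides have the same characteristic function. -/
lemma map_resample_stdGaussian {e : E} (he : ‖e‖ = 1) :
    ((gaussianReal 0 1).prod (stdGaussian E)).map (fun p => resample e p.1 p.2)
      = stdGaussian E := by
  have := Measure.isProbabilityMeasure_map (μ := (gaussianReal 0 1).prod (stdGaussian E))
    (measurable_resample e).aemeasurable
  apply Measure.ext_of_charFun
  ext v
  rw [charFun_apply, integral_map (measurable_resample e).aemeasurable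
    (Measurable.aestronglyMeasurable (by fun_prop))]
  have hsplit : ∀ p : ℝ × E,
      Complex.exp ((inner ℝ (resample e p.1 p.2) v : ℝ) * Complex.I)
        = Complex.exp ((inner ℝ v e : ℝ) * p.1 * Complex.I)
          * Complex.exp ((inner ℝ p.2 (v - (inner ℝ v e : ℝ) • e) : ℝ) * Complex.I) := by
    intro p
    rw [← Complex.exp_add, real_inner_comm, inner_resample, real_inner_comm p.2]
    congr 1
    push_cast
    ring
  simp_rw [hsplit]
  rw [integral_prod_mul (μ := gaussianReal 0 1) (ν := stdGaussian E)
    (fun z : ℝ => Complex.exp ((inner ℝ v e : ℝ) * z * Complex.I))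
    (fun x : E => Complex.exp ((inner ℝ x (v - (inner ℝ v e : ℝ) • e) : ℝ) * Complex.I)),
    ← charFun_apply_real, ← charFun_apply, charFun_gaussianReal, charFun_stdGaussian,
    charFun_stdGaussian, ← Complex.exp_add]
  have hn : ‖v - (inner ℝ v e : ℝ) • e‖ ^ 2 = ‖v‖ ^ 2 - (inner ℝ v e : ℝ) ^ 2 := by
    rw [norm_sub_sq_real, norm_smul, inner_smul_right, mul_pow, he, Real.norm_eq_abs, sq_abs]
    ring
  congr 1
  rw [← Complex.ofReal_pow ‖v - _‖, hn]
  push_cast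
  ring

lemma integral_stdGaussian_resample {e : E} (he : ‖e‖ = 1) {F : E → ℝ} (hF : Measurable F)
    {B : ℝ} (hB : ∀ x, |F x| ≤ B) :
    ∫ x, F x ∂(stdGaussian E)
      = ∫ x, ∫ z, F (resample e z x) ∂(gaussianReal 0 1) ∂(stdGaussian E) := by
  conv_lhs => rw [← map_resample_stdGaussian he]
  rw [integral_map (measurable_resample e).aemeasurable hF.aestronglyMeasurable]
  refine integral_prod_symm (fun p : ℝ × E => F (resample e p.1 p.2)) ?_
  exact Integrable.of_bound (hF.comp (measurable_resample e)).aestronglyMeasurable B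
    (.of_forall fun p => hB _)

end Resample

/-! ### One-dimensional Gaussian integrals of the test functions -/

lemma gaussianPDFReal_zero_one (x : ℝ) :
    gaussianPDFReal 0 1 x = (√(2 * Real.pi))⁻¹ * Real.exp (-x ^ 2 / 2) := by
  simp [gaussianPDFReal]

lemma one_le_sqrt_two_pi : 1 ≤ √(2 * Real.pi) := by
  rw [Real.one_le_sqrt]; nlinarith [Real.pi_gt_three]

lemma gaussianPDFReal_zero_one_le_one (x : ℝ) : gaussianPDFReal 0 1 x ≤ 1 := by
  rw [gaussianPDFReal_zero_one]
  have h1 : (√(2 * Real.pi))⁻¹ ≤ 1 := inv_le_one_of_one_le₀ one_le_sqrt_two_pi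
  have h2 : Real.exp (-x ^ 2 / 2) ≤ 1 := Real.exp_le_one_iff.2 (by nlinarith [sq_nonneg x])
  exact mul_le_one₀ h1 (Real.exp_pos _).le h2

lemma gaussianReal_zero_one_le_volume : gaussianReal 0 1 ≤ (volume : Measure ℝ) := by
  rw [gaussianReal_of_var_ne_zero 0 one_ne_zero]
  refine (withDensity_mono (g := 1) (.of_forall fun x => ?_)).trans (by rw [withDensity_one])
  simpa [gaussianPDF] using ENNReal.ofReal_le_ofReal (gaussianPDFReal_zero_one_le_one x)

lemma abs_mul_exp_neg_sq_le_one (x : ℝ) : |x * Real.exp (-x ^ 2 / 2)| ≤ 1 := by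
  rw [abs_mul, abs_of_pos (Real.exp_pos _), neg_div, Real.exp_neg, ← div_eq_mul_inv,
    div_le_one (Real.exp_pos _)]
  have := Real.add_one_le_exp (x ^ 2 / 2)
  nlinarith [sq_abs x, sq_nonneg (|x| - 1)]

lemma hasDerivAt_exp_neg_sq (x : ℝ) :
    HasDerivAt (fun x : ℝ => Real.exp (-x ^ 2 / 2)) (-(x * Real.exp (-x ^ 2 / 2))) x := by
  have h : HasDerivAt (fun x : ℝ => -x ^ 2 / 2) (-x) x := by
    have := ((hasDerivAt_pow 2 x).neg).div_const 2
    refine this.congr_deriv ?_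
    norm_num; ring
  exact h.exp.congr_deriv (by ring)

lemma abs_gaussianPDFReal_sub_le (x y : ℝ) :
    |gaussianPDFReal 0 1 x - gaussianPDFReal 0 1 y| ≤ |x - y| := by
  have h := Convex.norm_image_sub_le_of_norm_hasDerivWithin_le (𝕜 := ℝ) (C := 1) (s := Set.univ)
    (f := fun x : ℝ => Real.exp (-x ^ 2 / 2))
    (fun z _ => (hasDerivAt_exp_neg_sq z).hasDerivWithinAt)
    (fun z _ => by simpa using abs_mul_exp_neg_sq_le_one z) convex_univ
    (Set.mem_univ y) (Set.mem_univ x)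
  rw [one_mul, Real.norm_eq_abs, Real.norm_eq_abs] at h
  rw [gaussianPDFReal_zero_one, gaussianPDFReal_zero_one, ← mul_sub, abs_mul,
    abs_of_nonneg (by positivity)]
  have h1 : (√(2 * Real.pi))⁻¹ ≤ 1 := inv_le_one_of_one_le₀ one_le_sqrt_two_pi
  calc _ ≤ 1 * |x - y| := by gcongr
    _ = _ := one_mul _

/-- An odd bump supported in `[-1, 1]`, used to detect a jump. -/
def bump (x : ℝ) : ℝ := x * max 0 (1 - |x|)

lemma bump_neg (x : ℝ) : bump (-x) = -bump x := by simp [bump]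

lemma bump_eq_zero {x : ℝ} (hx : 1 ≤ |x|) : bump x = 0 := by
  rw [bump, max_eq_left (by linarith), mul_zero]

lemma bump_of_mem {x : ℝ} (h0 : 0 ≤ x) (h1 : x ≤ 1) : bump x = x * (1 - x) := by
  rw [bump, abs_of_nonneg h0, max_eq_right (by linarith)]

lemma bump_nonneg {x : ℝ} (hx : 0 ≤ x) : 0 ≤ bump x := mul_nonneg hx (le_max_left _ _)

lemma abs_bump_le_one (x : ℝ) : |bump x| ≤ 1 := by
  rw [bump, abs_mul, abs_of_nonneg (le_max_left 0 (1 - |x|))]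
  rcases max_cases 0 (1 - |x|) with ⟨h, _⟩ | ⟨h, _⟩ <;> rw [h] <;> nlinarith [abs_nonneg x]

lemma continuous_bump : Continuous bump := by unfold bump; fun_prop

lemma abs_bump_sub_le (x y : ℝ) : |bump x - bump y| ≤ |x - y| := by
  -- by oddness it is enough to treat `|y| ≤ |x|` with `x ≥ 0`
  have key : ∀ x y : ℝ, 0 ≤ x → |y| ≤ x → |bump x - bump y| ≤ x - y := by
    intro x y hx hy
    obtain ⟨hy1, hy2⟩ := abs_le.1 hy
    unfold bump
    rw [abs_of_nonneg hx]
    rcases abs_cases y with ⟨h, h'⟩ | ⟨h, h'⟩ <;> rw [h] <;>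
    rcases max_cases 0 (1 - x) with ⟨h1, h1'⟩ | ⟨h1, h1'⟩ <;> rw [h1] <;>
    first
    | rcases max_cases 0 (1 - y) with ⟨h2, h2'⟩ | ⟨h2, h2'⟩ <;> rw [h2] <;>
      rw [abs_le] <;> constructor <;> nlinarith
    | rcases max_cases 0 (1 - -y) with ⟨h2, h2'⟩ | ⟨h2, h2'⟩ <;> rw [h2] <;>
      rw [abs_le] <;> constructor <;> nlinarith
  have key' : ∀ x y : ℝ, |y| ≤ |x| → |bump x - bump y| ≤ |x - y| := by
    intro x y h
    rcases abs_cases x with ⟨h1, h2⟩ | ⟨h1, h2⟩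
    · exact (key x y h2 (h1 ▸ h)).trans (le_abs_self _)
    · have := key (-x) (-y) (by linarith) (by rwa [abs_neg, ← h1])
      rw [bump_neg, bump_neg, ← neg_sub', abs_neg] at this
      exact this.trans (by rw [abs_sub_comm]; exact (le_of_eq (by ring)).trans (le_abs_self _))
  rcases le_total |y| |x| with h | h
  · exact key' x y h
  · rw [abs_sub_comm, abs_sub_comm x]; exact key' y x h

lemma measurable_sgnAct (t : ℝ) : Measurable (sgnAct t) :=
  Measurable.ite measurableSet_Ici measurable_const measurable_const

lemma sgnAct_eq_zero_or_one (t a : ℝ) : sgnAct t a = 0 ∨ sgnAct t a = 1 := by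
  unfold sgnAct; split_ifs <;> simp

lemma abs_sgnAct_le_one (t a : ℝ) : |sgnAct t a| ≤ 1 := by
  rcases sgnAct_eq_zero_or_one t a with h | h <;> simp [h]

lemma integral_gaussianReal_eq (g : ℝ → ℝ) :
    ∫ z, g z ∂(gaussianReal 0 1) = ∫ z, gaussianPDFReal 0 1 z * g z :=
  integral_gaussianReal_eq_integral_smul one_ne_zero

/-- The support of `z ↦ bump (k * (z - s))`. -/
def bumpInterval (k s : ℝ) : Set ℝ := Set.Icc (s - 1 / |k|) (s + 1 / |k|)

lemma mem_bumpInterval_iff {k s z : ℝ} (hk : k ≠ 0) :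
    z ∈ bumpInterval k s ↔ |k * (z - s)| ≤ 1 := by
  have hk' : 0 < |k| := abs_pos.2 hk
  rw [bumpInterval, abs_mul, mul_comm, ← le_div_iff₀ hk', abs_le, Set.mem_Icc]
  constructor <;> rintro ⟨h1, h2⟩ <;> constructor <;> linarith

lemma bump_eq_zero_of_notMem_bumpInterval {k s z : ℝ} (hk : k ≠ 0) (hz : z ∉ bumpInterval k s) :
    bump (k * (z - s)) = 0 := by
  rw [mem_bumpInterval_iff hk, not_le] at hz
  exact bump_eq_zero hz.le

lemma volume_real_bumpInterval (k s : ℝ) : volume.real (bumpInterval k s) = 2 / |k| := by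
  have : 0 ≤ 1 / |k| := by positivity
  rw [bumpInterval, Real.volume_real_Icc_of_le (by linarith)]
  ring

lemma volume_bumpInterval_lt_top (k s : ℝ) : volume (bumpInterval k s) < ⊤ :=
  isCompact_Icc.measure_lt_top

lemma gaussianReal_real_bumpInterval_le (k s : ℝ) :
    (gaussianReal 0 1).real (bumpInterval k s) ≤ 2 / |k| := by
  rw [← volume_real_bumpInterval k s]
  exact ENNReal.toReal_mono (volume_bumpInterval_lt_top k s).ne
    (gaussianReal_zero_one_le_volume _)

lemma continuous_gaussianPDFReal_zero_one : Continuous (gaussianPDFReal 0 1) := by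
  unfold gaussianPDFReal; fun_prop

lemma setIntegral_bump_eq_zero {k : ℝ} (hk : k ≠ 0) (s : ℝ) :
    ∫ z in bumpInterval k s, bump (k * (z - s)) = 0 := by
  rw [setIntegral_eq_integral_of_forall_compl_eq_zero
    (fun z hz => bump_eq_zero_of_notMem_bumpInterval hk hz),
    integral_sub_right_eq_self (fun z => bump (k * z)) s]
  have h := integral_neg_eq_self (fun z => bump (k * z)) volume
  simp only [mul_neg, bump_neg, integral_neg] at h
  linarith

/-- Being odd, the bump only sees the variation of the Gaussian density over its support. -/
lemma abs_integral_bump_le {k : ℝ} (hk : k ≠ 0) (s : ℝ) :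
    |∫ z, bump (k * (z - s)) ∂(gaussianReal 0 1)| ≤ 2 / k ^ 2 := by
  have hk' : 0 < |k| := abs_pos.2 hk
  have hb : Continuous fun z => bump (k * (z - s)) := continuous_bump.comp (by fun_prop)
  have hφ := continuous_gaussianPDFReal_zero_one
  have hcenter : ∫ z, bump (k * (z - s)) ∂(gaussianReal 0 1)
      = ∫ z in bumpInterval k s,
          (gaussianPDFReal 0 1 z - gaussianPDFReal 0 1 s) * bump (k * (z - s)) := by
    rw [integral_gaussianReal_eq, ← setIntegral_eq_integral_of_forall_compl_eq_zero
      (s := bumpInterval k s)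
      (fun z hz => by rw [bump_eq_zero_of_notMem_bumpInterval hk hz, mul_zero])]
    simp_rw [sub_mul]
    have hsub := integral_sub (μ := volume.restrict (bumpInterval k s))
      (f := fun z => gaussianPDFReal 0 1 z * bump (k * (z - s)))
      (g := fun z => gaussianPDFReal 0 1 s * bump (k * (z - s)))
      (hφ.mul hb).continuousOn.integrableOn_Icc (hb.const_mul _).continuousOn.integrableOn_Icc
    rw [hsub, integral_const_mul, setIntegral_bump_eq_zero hk, mul_zero, sub_zero]
  rw [hcenter, ← Real.norm_eq_abs]
  refine (norm_setIntegral_le_of_norm_le_const (C := 1 / |k|) (volume_bumpInterval_lt_top k s)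
    fun z hz => ?_).trans ?_
  · rw [Real.norm_eq_abs, abs_mul]
    have h1 : |z - s| ≤ 1 / |k| := by
      rw [mem_bumpInterval_iff hk, abs_mul] at hz
      rwa [le_div_iff₀ hk', mul_comm]
    calc _ ≤ |z - s| * 1 := mul_le_mul (abs_gaussianPDFReal_sub_le z s) (abs_bump_le_one _)
          (abs_nonneg _) (abs_nonneg _)
      _ ≤ _ := by rwa [mul_one]
  · rw [volume_real_bumpInterval, ← sq_abs k]
    apply le_of_eq; field_simp

lemma abs_integral_sgnAct_bump_le {k : ℝ} (hk : k ≠ 0) (t s : ℝ) :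
    |∫ z, sgnAct t z * bump (k * (z - s)) ∂(gaussianReal 0 1)| ≤ 2 / |k| := by
  rw [← setIntegral_eq_integral_of_forall_compl_eq_zero (s := bumpInterval k s)
      (fun z hz => by rw [bump_eq_zero_of_notMem_bumpInterval hk hz, mul_zero]), ← Real.norm_eq_abs]
  refine (norm_setIntegral_le_of_norm_le_const (C := 1) (measure_lt_top _ _)
    fun z _ => ?_).trans ?_
  · rw [norm_mul]
    exact mul_le_one₀ (abs_sgnAct_le_one t z) (norm_nonneg _) (abs_bump_le_one _)
  · rw [one_mul]; exact gaussianReal_real_bumpInterval_le k s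

/-- A threshold outside the support of the bump does not interact with it. -/
lemma abs_integral_sgnAct_bump_le_of_lt {k : ℝ} (hk : k ≠ 0) {t s : ℝ} (h : 1 < |k * (t - s)|) :
    |∫ z, sgnAct t z * bump (k * (z - s)) ∂(gaussianReal 0 1)| ≤ 2 / k ^ 2 := by
  have ht : t ∉ bumpInterval k s := fun h' => absurd ((mem_bumpInterval_iff hk).1 h') (not_le.2 h)
  have hconst : ∃ b : ℝ, |b| ≤ 1 ∧ ∀ z, sgnAct t z * bump (k * (z - s))
      = b * bump (k * (z - s)) := by
    rw [bumpInterval, Set.mem_Icc, not_and_or, not_le, not_le] at ht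
    rcases ht with ht | ht
    · refine ⟨1, by simp, fun z => ?_⟩
      by_cases hz : z ∈ bumpInterval k s
      · rw [sgnAct, if_pos (ht.le.trans hz.1)]
      · rw [bump_eq_zero_of_notMem_bumpInterval hk hz, mul_zero, mul_zero]
    · refine ⟨0, by simp, fun z => ?_⟩
      by_cases hz : z ∈ bumpInterval k s
      · rw [sgnAct, if_neg (not_le.2 (hz.2.trans_lt ht))]
      · rw [bump_eq_zero_of_notMem_bumpInterval hk hz, mul_zero, mul_zero]
  obtain ⟨b, hb, hbz⟩ := hconst
  simp_rw [hbz]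
  rw [integral_const_mul, abs_mul]
  calc _ ≤ 1 * (2 / k ^ 2) := by
        gcongr
        exact abs_integral_bump_le hk s
    _ = _ := one_mul _

/-- A bump centred at the threshold sees only its positive half. -/
lemma le_integral_sgnAct_bump {k : ℝ} (hk : 0 < k) (t : ℝ) :
    (gaussianPDFReal 0 1 t - 1 / k) / (6 * k)
      ≤ ∫ z, sgnAct t z * bump (k * (z - t)) ∂(gaussianReal 0 1) := by
  have hk1 : t ≤ t + 1 / k := by have : 0 < 1 / k := by positivity
                                 linarith
  have hb : Continuous fun z => bump (k * (z - t)) := continuous_bump.comp (by fun_prop)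
  have hφ := continuous_gaussianPDFReal_zero_one
  have hmem : ∀ z ∈ Set.Icc t (t + 1 / k), 0 ≤ k * (z - t) ∧ k * (z - t) ≤ 1 := fun z hz => by
    refine ⟨mul_nonneg hk.le (by linarith [hz.1]), ?_⟩
    have : z - t ≤ 1 / k := by linarith [hz.2]
    rwa [le_div_iff₀ hk, mul_comm] at this
  have hint : ∫ z in Set.Icc t (t + 1 / k), bump (k * (z - t)) = 1 / (6 * k) := by
    rw [setIntegral_congr_fun measurableSet_Icc
      (g := fun z => k * (z - t) * (1 - k * (z - t)))
      (fun z hz => bump_of_mem (hmem z hz).1 (hmem z hz).2), integral_Icc_eq_integral_Ioc,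
      ← intervalIntegral.integral_of_le hk1]
    have hderiv : ∀ z ∈ Set.uIcc t (t + 1 / k), HasDerivAt
        (fun z => k * (z - t) ^ 2 / 2 - k ^ 2 * (z - t) ^ 3 / 3)
        (k * (z - t) * (1 - k * (z - t))) z := fun z _ => by
      have h1 : HasDerivAt (fun z => z - t) 1 z := (hasDerivAt_id z).sub_const t
      refine ((((h1.pow 2).const_mul k).div_const 2).sub
        (((h1.pow 3).const_mul (k ^ 2)).div_const 3)).congr_deriv ?_
      norm_num; ring
    rw [intervalIntegral.integral_eq_sub_of_hasDerivAt hderiv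
      (Continuous.intervalIntegrable (by fun_prop) _ _)]
    field_simp; ring
  have hrestrict : ∫ z, sgnAct t z * bump (k * (z - t)) ∂(gaussianReal 0 1)
      = ∫ z in Set.Icc t (t + 1 / k), gaussianPDFReal 0 1 z * bump (k * (z - t)) := by
    rw [integral_gaussianReal_eq, ← setIntegral_eq_integral_of_forall_compl_eq_zero
      (s := Set.Icc t (t + 1 / k))]
    · refine setIntegral_congr_fun measurableSet_Icc fun z hz => ?_
      simp only [sgnAct, if_pos hz.1, one_mul]
    · intro z hz
      by_cases h : t ≤ z
      · rw [bump_eq_zero, mul_zero, mul_zero]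
        rw [Set.mem_Icc, not_and, not_le] at hz
        have := hz h
        rw [← lt_sub_iff_add_lt', div_lt_iff₀ hk, mul_comm] at this
        exact this.le.trans (le_abs_self _)
      · simp [sgnAct, h]
  have hlow : ∫ z in Set.Icc t (t + 1 / k), (gaussianPDFReal 0 1 t - 1 / k) * bump (k * (z - t))
      ≤ ∫ z in Set.Icc t (t + 1 / k), gaussianPDFReal 0 1 z * bump (k * (z - t)) := by
    refine setIntegral_mono_on (hb.const_mul _).continuousOn.integrableOn_Icc
      (hφ.mul hb).continuousOn.integrableOn_Icc measurableSet_Icc fun z hz => ?_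
    refine mul_le_mul_of_nonneg_right ?_ (bump_nonneg (hmem z hz).1)
    have := (abs_le.1 (abs_gaussianPDFReal_sub_le z t)).1
    rw [abs_of_nonneg (by linarith [hz.1])] at this
    linarith [hz.2]
  rw [integral_const_mul, hint] at hlow
  rw [hrestrict]
  refine le_trans (le_of_eq ?_) hlow
  ring

/-- An odd, bounded, Lipschitz function with explicit Gaussian integrals over half-lines. -/
noncomputable def oddWeight (x : ℝ) : ℝ := x * Real.exp (-x ^ 2 / 2)

lemma oddWeight_neg (x : ℝ) : oddWeight (-x) = -oddWeight x := by simp [oddWeight]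

lemma abs_oddWeight_le_one (x : ℝ) : |oddWeight x| ≤ 1 := abs_mul_exp_neg_sq_le_one x

lemma continuous_oddWeight : Continuous oddWeight := by unfold oddWeight; fun_prop

lemma abs_oddWeight_sub_le (x y : ℝ) : |oddWeight x - oddWeight y| ≤ |x - y| := by
  have h := Convex.norm_image_sub_le_of_norm_hasDerivWithin_le (𝕜 := ℝ) (C := 1) (s := Set.univ)
    (f := oddWeight) (f' := fun z => (1 - z ^ 2) * Real.exp (-z ^ 2 / 2))
    (fun z _ => (((hasDerivAt_id z).mul (hasDerivAt_exp_neg_sq z)).congr_deriv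
      (by simp; ring)).hasDerivWithinAt)
    (fun z _ => ?_) convex_univ (Set.mem_univ y) (Set.mem_univ x)
  · rwa [one_mul] at h
  · rw [Real.norm_eq_abs, abs_mul, abs_of_pos (Real.exp_pos _), neg_div, Real.exp_neg,
      ← div_eq_mul_inv, div_le_one (Real.exp_pos _), abs_le]
    have := Real.quadratic_le_exp_of_nonneg (x := z ^ 2 / 2) (by positivity)
    constructor <;> nlinarith [sq_nonneg z, sq_nonneg (z ^ 2 - 2)]

lemma integral_oddWeight : ∫ z, oddWeight z ∂(gaussianReal 0 1) = 0 := by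
  rw [integral_gaussianReal_eq]
  have h := integral_neg_eq_self (fun z => gaussianPDFReal 0 1 z * oddWeight z) volume
  simp only [oddWeight_neg, gaussianPDFReal_zero_one, even_two, Even.neg_pow, mul_neg,
    integral_neg] at h
  simp only [gaussianPDFReal_zero_one]
  linarith

lemma le_integral_sgnAct_oddWeight (t : ℝ) :
    gaussianPDFReal 0 1 t ^ 2 ≤ ∫ z, sgnAct t z * oddWeight z ∂(gaussianReal 0 1) := by
  set c : ℝ := (√(2 * Real.pi))⁻¹ with hc
  have hc0 : 0 ≤ c := by positivity
  have hprod : ∀ z : ℝ, gaussianPDFReal 0 1 z * oddWeight z = c * (z * Real.exp (-z ^ 2)) := by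
    intro z
    have he : Real.exp (-z ^ 2) = Real.exp (-z ^ 2 / 2) * Real.exp (-z ^ 2 / 2) := by
      rw [← Real.exp_add, add_halves]
    rw [gaussianPDFReal_zero_one, oddWeight, he, ← hc]
    ring
  have hrestrict : ∫ z, sgnAct t z * oddWeight z ∂(gaussianReal 0 1)
      = ∫ z in Set.Ici t, c * (z * Real.exp (-z ^ 2)) := by
    rw [integral_gaussianReal_eq, ← integral_indicator measurableSet_Ici]
    congr 1; ext z
    by_cases hz : t ≤ z
    · rw [Set.indicator_of_mem (show z ∈ Set.Ici t from hz), ← hprod, sgnAct, if_pos hz, one_mul]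
    · rw [Set.indicator_of_notMem (show z ∉ Set.Ici t from hz), sgnAct, if_neg hz, zero_mul,
        mul_zero]
  have hderiv : ∀ z ∈ Set.Ici t, HasDerivAt (fun z : ℝ => -(c / 2) * Real.exp (-z ^ 2))
      (c * (z * Real.exp (-z ^ 2))) z := fun z _ => by
    have h1 : HasDerivAt (fun z : ℝ => -z ^ 2) (-(2 * z)) z :=
      (hasDerivAt_pow 2 z).neg.congr_deriv (by norm_num)
    exact (h1.exp.const_mul (-(c / 2))).congr_deriv (by ring)
  have hinte : IntegrableOn (fun z : ℝ => c * (z * Real.exp (-z ^ 2))) (Set.Ioi t) := by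
    have := (integrable_mul_exp_neg_mul_sq (b := 1) one_pos).const_mul c
    simp only [neg_mul, one_mul] at this
    exact this.integrableOn
  have hlim : Filter.Tendsto (fun z : ℝ => -(c / 2) * Real.exp (-z ^ 2)) Filter.atTop (nhds 0) := by
    rw [← mul_zero (-(c / 2))]
    refine Filter.Tendsto.const_mul _ (Real.tendsto_exp_atBot.comp ?_)
    exact Filter.tendsto_neg_atTop_atBot.comp (Filter.tendsto_pow_atTop two_ne_zero)
  rw [hrestrict, integral_Ici_eq_integral_Ioi, integral_Ioi_of_hasDerivAt_of_tendsto' hderiv hinte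
    hlim, gaussianPDFReal_zero_one, mul_pow, ← Real.exp_nat_mul, ← hc]
  have hc2 : c ≤ 1 / 2 := by
    rw [hc, inv_le_comm₀ (by positivity) (by norm_num)]
    refine Real.le_sqrt_of_sq_le ?_
    nlinarith [Real.pi_gt_three]
  have he : ((2 : ℕ) : ℝ) * (-t ^ 2 / 2) = -t ^ 2 := by push_cast; ring
  rw [he]
  nlinarith [Real.exp_pos (-t ^ 2), mul_nonneg hc0 (Real.exp_pos (-t ^ 2)).le]

/-! ### The expected jump of the network across a hyperplane -/

/-- The input space of the network. -/
abbrev Inputs (n : ℕ) : Type := EuclideanSpace ℝ (Fin n)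

section Network

variable {d n : ℕ}

lemma measurable_hiddenLayer (t : ℝ) (w : Fin d → Inputs n) : Measurable (hiddenLayer t w) :=
  measurable_pi_lambda _ fun i => (measurable_sgnAct t).comp (by fun_prop)

lemma hiddenLayer_eq_zero_or_one (t : ℝ) (w : Fin d → Inputs n) (x : Inputs n) (i : Fin d) :
    hiddenLayer t w x i = 0 ∨ hiddenLayer t w x i = 1 := sgnAct_eq_zero_or_one _ _

lemma measurable_eval (P : MvPolynomial (Fin d) ℝ) {f : Inputs n → Fin d → ℝ} (hf : Measurable f) :
    Measurable fun x => MvPolynomial.eval (f x) P :=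
  P.continuous_eval.measurable.comp hf

lemma measurable_network (P : MvPolynomial (Fin d) ℝ) (t : ℝ) (w : Fin d → Inputs n) :
    Measurable (network P t w) := measurable_eval P (measurable_hiddenLayer t w)

/-- The network with the `j`-th hidden unit clamped to the value `b`. -/
noncomputable def clampedNetwork (P : MvPolynomial (Fin d) ℝ) (t : ℝ) (w : Fin d → Inputs n)
    (j : Fin d) (b : ℝ) (x : Inputs n) : ℝ :=
  MvPolynomial.eval (Function.update (hiddenLayer t w x) j b) P

/-- The jump of the network when the `j`-th hidden unit switches on. -/
noncomputable def jump (P : MvPolynomial (Fin d) ℝ) (t : ℝ) (w : Fin d → Inputs n) (j : Fin d)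
    (x : Inputs n) : ℝ :=
  clampedNetwork P t w j 1 x - clampedNetwork P t w j 0 x

lemma measurable_clampedNetwork (P : MvPolynomial (Fin d) ℝ) (t : ℝ) (w : Fin d → Inputs n)
    (j : Fin d) (b : ℝ) : Measurable (clampedNetwork P t w j b) :=
  measurable_eval P (measurable_update_left.comp (measurable_hiddenLayer t w))

/-- `P` is bounded by `B` on the vertices of the unit cube. -/
def BoundedOnCube (P : MvPolynomial (Fin d) ℝ) (B : ℝ) : Prop :=
  ∀ v : Fin d → ℝ, (∀ i, v i = 0 ∨ v i = 1) → |MvPolynomial.eval v P| ≤ B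

variable {P : MvPolynomial (Fin d) ℝ} {t B : ℝ} {w : Fin d → Inputs n}

lemma abs_network_le (hP : BoundedOnCube P B) (x : Inputs n) : |network P t w x| ≤ B :=
  hP _ fun i => hiddenLayer_eq_zero_or_one t w x i

lemma abs_clampedNetwork_le (hP : BoundedOnCube P B) (j : Fin d) {b : ℝ} (hb : b = 0 ∨ b = 1)
    (x : Inputs n) : |clampedNetwork P t w j b x| ≤ B := by
  refine hP _ fun i => ?_
  rcases eq_or_ne i j with rfl | h
  · simpa using hb
  · simpa [h] using hiddenLayer_eq_zero_or_one t w x i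

lemma abs_jump_le (hP : BoundedOnCube P B) (j : Fin d) (x : Inputs n) :
    |jump P t w j x| ≤ 2 * B := by
  have h0 := abs_clampedNetwork_le (t := t) (w := w) hP j (Or.inl rfl) x
  have h1 := abs_clampedNetwork_le (t := t) (w := w) hP j (Or.inr rfl) x
  exact (abs_sub _ _).trans (by linarith)

lemma network_eq_clampedNetwork_add (P : MvPolynomial (Fin d) ℝ) (t : ℝ) (w : Fin d → Inputs n)
    (j : Fin d) (x : Inputs n) :
    network P t w x = clampedNetwork P t w j 0 x + hiddenLayer t w x j * jump P t w j x := by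
  have h := Function.update_eq_self j (hiddenLayer t w x)
  rcases hiddenLayer_eq_zero_or_one t w x j with h0 | h0 <;> rw [h0] at h ⊢ <;>
    simp [network, jump, clampedNetwork, h]

lemma hiddenLayer_resample_of_inner_eq_zero (t : ℝ) {w : Fin d → Inputs n} {e : Inputs n}
    {k : Fin d} (h : inner ℝ (w k) e = 0) (z : ℝ) (x : Inputs n) :
    hiddenLayer t w (resample e z x) k = hiddenLayer t w x k := by
  simp [hiddenLayer, inner_resample, h]

lemma hiddenLayer_resample_self (t : ℝ) {w : Fin d → Inputs n} (hw : Orthonormal ℝ w) (j : Fin d)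
    (z : ℝ) (x : Inputs n) : hiddenLayer t w (resample (w j) z x) j = sgnAct t z := by
  simp [hiddenLayer, inner_resample, hw.1 j]

lemma clampedNetwork_resample (P : MvPolynomial (Fin d) ℝ) (t : ℝ) {w : Fin d → Inputs n}
    (hw : Orthonormal ℝ w) (j : Fin d) (b z : ℝ) (x : Inputs n) :
    clampedNetwork P t w j b (resample (w j) z x) = clampedNetwork P t w j b x := by
  unfold clampedNetwork
  refine congrArg (fun v => MvPolynomial.eval v P) (funext fun i => ?_)
  rcases eq_or_ne i j with rfl | h
  · simp
  · simp [h, hiddenLayer_resample_of_inner_eq_zero t (hw.2 h) z x]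

lemma network_resample (P : MvPolynomial (Fin d) ℝ) (t : ℝ) {w : Fin d → Inputs n}
    (hw : Orthonormal ℝ w) (j : Fin d) (z : ℝ) (x : Inputs n) :
    network P t w (resample (w j) z x)
      = clampedNetwork P t w j 0 x + sgnAct t z * jump P t w j x := by
  rw [network_eq_clampedNetwork_add P t w j, hiddenLayer_resample_self t hw,
    clampedNetwork_resample P t hw, jump, jump, clampedNetwork_resample P t hw,
    clampedNetwork_resample P t hw]

/-- The hidden units are independent. -/
lemma integral_prod_hiddenLayer (t : ℝ) {w : Fin d → Inputs n} (hw : Orthonormal ℝ w)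
    (S : Finset (Fin d)) :
    ∫ x, ∏ k ∈ S, hiddenLayer t w x k ∂(stdGaussian (Inputs n))
      = (∫ z, sgnAct t z ∂(gaussianReal 0 1)) ^ S.card := by
  classical
  induction S using Finset.induction_on with
  | empty => simp
  | insert j S hj ih =>
    have hmeas : Measurable fun x : Inputs n => ∏ k ∈ insert j S, hiddenLayer t w x k :=
      Finset.measurable_prod _ fun i _ => (measurable_pi_apply i).comp (measurable_hiddenLayer t w)
    have hbound : ∀ x : Inputs n, |∏ k ∈ insert j S, hiddenLayer t w x k| ≤ 1 := fun x => by
      rw [Finset.abs_prod]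
      exact Finset.prod_le_one (fun _ _ => abs_nonneg _) fun i _ => abs_sgnAct_le_one _ _
    have hstep : ∀ (x : Inputs n) (z : ℝ), ∏ k ∈ insert j S, hiddenLayer t w (resample (w j) z x) k
        = sgnAct t z * ∏ k ∈ S, hiddenLayer t w x k := fun x z => by
      rw [Finset.prod_insert hj, hiddenLayer_resample_self t hw]
      congr 1
      refine Finset.prod_congr rfl fun k hk => ?_
      exact hiddenLayer_resample_of_inner_eq_zero t (hw.2 fun h => hj (by rwa [← h])) z x
    rw [integral_stdGaussian_resample (hw.1 j) hmeas hbound]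
    simp_rw [hstep, integral_mul_const, integral_const_mul]
    rw [ih, Finset.card_insert_of_notMem hj, pow_succ, mul_comm]

lemma prod_update_sub_prod_update {R ι : Type*} [CommRing R] [DecidableEq ι] (v : ι → R) (j : ι)
    (S : Finset ι) :
    ∏ k ∈ S, Function.update v j 1 k - ∏ k ∈ S, Function.update v j 0 k
      = if j ∈ S then ∏ k ∈ S.erase j, v k else 0 := by
  have hne : ∀ b : R, ∏ k ∈ S.erase j, Function.update v j b k = ∏ k ∈ S.erase j, v k := fun b =>
    Finset.prod_congr rfl fun k hk => Function.update_of_ne (Finset.ne_of_mem_erase hk) _ _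
  split_ifs with h
  · rw [← Finset.mul_prod_erase S _ h, ← Finset.mul_prod_erase S (Function.update v j 0) h, hne,
      hne]
    simp
  · rw [← Finset.erase_eq_of_notMem h, hne, hne, sub_self]

lemma MvPolynomial.coeff_single_mul {R σ : Type*} [CommRing R] (j : σ) (p q : MvPolynomial σ R) :
    (p * q).coeff (Finsupp.single j 1)
      = p.coeff 0 * q.coeff (Finsupp.single j 1) + p.coeff (Finsupp.single j 1) * q.coeff 0 := by
  classical
  have h : ∀ r : MvPolynomial σ R, r.coeff (Finsupp.single j 1)
      = MvPolynomial.constantCoeff (MvPolynomial.pderiv j r) := fun r => by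
    rw [MvPolynomial.constantCoeff_eq, MvPolynomial.coeff_pderiv]
    simp
  rw [h, h p, h q, MvPolynomial.pderiv_mul]
  simp only [map_add, map_mul, MvPolynomial.constantCoeff_eq]
  ring

lemma coeff_zero_prod_shift (μ : ℝ) (S : Finset (Fin d)) :
    MvPolynomial.coeff 0 (∏ k ∈ S, MvPolynomial.C μ * (MvPolynomial.X k + 1)) = μ ^ S.card := by
  rw [← MvPolynomial.constantCoeff_eq, map_prod]
  simp

lemma coeff_single_prod_shift (μ : ℝ) (j : Fin d) (S : Finset (Fin d)) :
    MvPolynomial.coeff (Finsupp.single j 1) (∏ k ∈ S, MvPolynomial.C μ * (MvPolynomial.X k + 1))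
      = if j ∈ S then μ ^ S.card else 0 := by
  classical
  have h0 : (0 : Fin d →₀ ℕ) ≠ Finsupp.single j 1 := fun h => by
    simpa using (DFunLike.congr_fun h j)
  induction S using Finset.induction_on with
  | empty =>
    simpa [MvPolynomial.coeff_one] using h0
  | insert i S hi ih =>
    rw [Finset.prod_insert hi, MvPolynomial.coeff_single_mul, ih, coeff_zero_prod_shift,
      MvPolynomial.coeff_C_mul, MvPolynomial.coeff_C_mul, MvPolynomial.coeff_add,
      MvPolynomial.coeff_add, MvPolynomial.coeff_one, MvPolynomial.coeff_one, if_neg h0,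
      Finset.card_insert_of_notMem hi, MvPolynomial.coeff_zero_X, MvPolynomial.coeff_X]
    rcases eq_or_ne i j with rfl | hij
    · simp [hi, pow_succ, mul_comm]
    · have : ¬ Finsupp.single i 1 = Finsupp.single j 1 := fun h =>
        hij ((Finsupp.single_left_inj one_ne_zero).1 h)
      by_cases hj : j ∈ S <;> simp [hj, this, hij.symm, pow_succ, mul_comm]

/-- The coefficients of the linear monomials in the hypothesis are the expected jumps, up to the
factor `μ`. -/
lemma mul_integral_jump {P : MvPolynomial (Fin d) ℝ} (hP : ∀ i, P.degreeOf i ≤ 1) (t : ℝ)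
    {w : Fin d → Inputs n} (hw : Orthonormal ℝ w) (j : Fin d) :
    (∫ z, sgnAct t z ∂(gaussianReal 0 1)) * ∫ x, jump P t w j x ∂(stdGaussian (Inputs n))
      = MvPolynomial.coeff (Finsupp.single j 1)
          (shiftScale (∫ z, sgnAct t z ∂(gaussianReal 0 1)) P) := by
  classical
  set μ := ∫ z, sgnAct t z ∂(gaussianReal 0 1)
  have hone : ∀ m ∈ P.support, ∀ k ∈ m.support, m k = 1 := fun m hm k hk => by
    have h1 := MvPolynomial.degreeOf_le_iff.1 (hP k) m hm
    have h2 := Finsupp.mem_support_iff.1 hk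
    omega
  have heval : ∀ v : Fin d → ℝ, MvPolynomial.eval v P
      = ∑ m ∈ P.support, P.coeff m * ∏ k ∈ m.support, v k := fun v => by
    rw [MvPolynomial.eval_eq]
    refine Finset.sum_congr rfl fun m hm => ?_
    rw [Finset.prod_congr rfl fun k hk => by rw [hone m hm k hk, pow_one]]
  have hjump : ∀ x, jump P t w j x = ∑ m ∈ P.support, P.coeff m *
      if j ∈ m.support then ∏ k ∈ m.support.erase j, hiddenLayer t w x k else 0 := fun x => by
    rw [jump, clampedNetwork, clampedNetwork, heval, heval, ← Finset.sum_sub_distrib]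
    refine Finset.sum_congr rfl fun m _ => ?_
    rw [← mul_sub, prod_update_sub_prod_update]
  have hprod : ∀ S : Finset (Fin d), Integrable
      (fun x => ∏ k ∈ S, hiddenLayer t w x k) (stdGaussian (Inputs n)) := fun S => by
    refine Integrable.of_bound (Measurable.aestronglyMeasurable ?_) 1 (.of_forall fun x => ?_)
    · exact Finset.measurable_prod _
        fun i _ => (measurable_pi_apply i).comp (measurable_hiddenLayer t w)
    · rw [Real.norm_eq_abs, Finset.abs_prod]
      exact Finset.prod_le_one (fun _ _ => abs_nonneg _) fun i _ => abs_sgnAct_le_one _ _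
  have hshift : shiftScale μ P = ∑ m ∈ P.support, MvPolynomial.C (P.coeff m) *
      ∏ k ∈ m.support, MvPolynomial.C μ * (MvPolynomial.X k + 1) := by
    rw [shiftScale, MvPolynomial.bind₁, MvPolynomial.aeval_def, MvPolynomial.eval₂_eq]
    refine Finset.sum_congr rfl fun m hm => ?_
    rw [Finset.prod_congr rfl fun k hk => by rw [hone m hm k hk, pow_one]]
    rfl
  simp_rw [hjump]
  rw [integral_finsetSum, hshift, MvPolynomial.coeff_sum, Finset.mul_sum]
  · refine Finset.sum_congr rfl fun m _ => ?_
    rw [integral_const_mul, MvPolynomial.coeff_C_mul, coeff_single_prod_shift]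
    split_ifs with h
    · rw [integral_prod_hiddenLayer t hw, mul_left_comm, ← pow_succ',
        Finset.card_erase_add_one h]
    · simp
  · intro m _
    refine Integrable.const_mul ?_ _
    split_ifs
    · exact hprod _
    · exact integrable_zero _ _ _

end Network

/-! ### Correlations of the network with test functions of one direction -/

section Correlation

variable {d n : ℕ}

lemma integrable_inner_stdGaussian (v : Inputs n) :
    Integrable (fun x => inner ℝ v x) (stdGaussian (Inputs n)) :=
  IsGaussian.integrable_dual (stdGaussian (Inputs n)) (innerSL ℝ v)

lemma integral_inner_sq_stdGaussian (v : Inputs n) :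
    ∫ x, (inner ℝ v x : ℝ) ^ 2 ∂(stdGaussian (Inputs n)) = ‖v‖ ^ 2 := by
  have h := variance_dual_stdGaussian (E := Inputs n) (innerSL ℝ v)
  rw [variance_of_integral_eq_zero (by fun_prop) (integral_strongDual_stdGaussian _),
    innerSL_apply_norm] at h
  simpa [innerSL_apply_apply] using h

lemma integral_abs_inner_stdGaussian_le (v : Inputs n) :
    ∫ x, |(inner ℝ v x : ℝ)| ∂(stdGaussian (Inputs n)) ≤ ‖v‖ := by
  rcases eq_or_ne v 0 with rfl | hv
  · simp
  have hv' : 0 < ‖v‖ := norm_pos_iff.2 hv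
  have hsq : Integrable (fun x => (inner ℝ v x : ℝ) ^ 2) (stdGaussian (Inputs n)) :=
    (IsGaussian.memLp_dual (stdGaussian (Inputs n)) (innerSL ℝ v) 2 (by simp)).integrable_sq
  -- the arithmetic-geometric mean inequality with weight `‖v‖`
  calc ∫ x, |(inner ℝ v x : ℝ)| ∂(stdGaussian (Inputs n))
      ≤ ∫ x, (‖v‖ / 2 + (inner ℝ v x : ℝ) ^ 2 / (2 * ‖v‖)) ∂(stdGaussian (Inputs n)) := by
        refine integral_mono (integrable_inner_stdGaussian v).abs
          ((integrable_const _).add (hsq.div_const _)) fun x => ?_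
        have h := sq_nonneg (‖v‖ - |(inner ℝ v x : ℝ)|)
        simp only
        rw [← sq_abs (inner ℝ v x : ℝ)]
        generalize |(inner ℝ v x : ℝ)| = y at *
        have h2 : ‖v‖ / 2 + y ^ 2 / (2 * ‖v‖) - y = (‖v‖ - y) ^ 2 / (2 * ‖v‖) := by
          field_simp; ring
        have : 0 ≤ (‖v‖ - y) ^ 2 / (2 * ‖v‖) := by positivity
        linarith
    _ = ‖v‖ := by
        rw [integral_add (integrable_const _) (hsq.div_const _), integral_div (2 * ‖v‖),
          integral_inner_sq_stdGaussian]
        simp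
        field_simp; ring

/-- The correlation of the network with the test function `ψ` in direction `u`. -/
noncomputable def correlation (P : MvPolynomial (Fin d) ℝ) (t : ℝ) (w : Fin d → Inputs n)
    (ψ : ℝ → ℝ) (u : Inputs n) : ℝ :=
  ∫ x, network P t w x * ψ (inner ℝ u x) ∂(stdGaussian (Inputs n))

variable {P : MvPolynomial (Fin d) ℝ} {t B : ℝ} {w : Fin d → Inputs n} {ψ : ℝ → ℝ}

lemma BoundedOnCube.nonneg (hP : BoundedOnCube P B) : 0 ≤ B :=
  (abs_nonneg _).trans (hP 0 fun _ => Or.inl rfl)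

lemma abs_network_mul_le (hP : BoundedOnCube P B) (hψ : ∀ s, |ψ s| ≤ 1) (u x : Inputs n) :
    |network P t w x * ψ (inner ℝ u x)| ≤ B := by
  rw [abs_mul]
  calc _ ≤ B * 1 := mul_le_mul (abs_network_le hP x) (hψ _) (abs_nonneg _) hP.nonneg
    _ = B := mul_one B

lemma measurable_network_mul (hψm : Measurable ψ) (u : Inputs n) :
    Measurable fun x => network P t w x * ψ (inner ℝ u x) :=
  (measurable_network P t w).mul (hψm.comp (by fun_prop))

lemma correlation_neg (hψ : ∀ s, ψ (-s) = -ψ s) (u : Inputs n) :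
    correlation P t w ψ (-u) = -correlation P t w ψ u := by
  simp [correlation, hψ, integral_neg]

lemma abs_correlation_sub_le (hP : BoundedOnCube P B) (hψm : Measurable ψ)
    (hψ : ∀ s, |ψ s| ≤ 1) {L : ℝ} (hL : ∀ r s, |ψ r - ψ s| ≤ L * |r - s|) (u v : Inputs n) :
    |correlation P t w ψ u - correlation P t w ψ v| ≤ B * L * ‖u - v‖ := by
  have hL0 : 0 ≤ L := by simpa using (abs_nonneg _).trans (hL 1 0)
  have hint : ∀ u, Integrable (fun x => network P t w x * ψ (inner ℝ u x))
      (stdGaussian (Inputs n)) := fun u =>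
    Integrable.of_bound (measurable_network_mul hψm u).aestronglyMeasurable B
      (.of_forall fun x => abs_network_mul_le hP hψ u x)
  rw [correlation, correlation, ← integral_sub (hint u) (hint v), ← Real.norm_eq_abs]
  refine (norm_integral_le_of_norm_le (g := fun x => B * L * |(inner ℝ (u - v) x : ℝ)|)
    ((integrable_inner_stdGaussian _).abs.const_mul _) (.of_forall fun x => ?_)).trans ?_
  · rw [← mul_sub, norm_mul, inner_sub_left, mul_assoc]
    exact mul_le_mul (abs_network_le hP x) (hL _ _) (norm_nonneg _) hP.nonneg
  · rw [integral_const_mul]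
    have := hP.nonneg
    gcongr
    exact integral_abs_inner_stdGaussian_le _

lemma correlation_eq_resample (hP : BoundedOnCube P B) (hw : Orthonormal ℝ w)
    (hψm : Measurable ψ) (hψ : ∀ s, |ψ s| ≤ 1) (u : Inputs n) (j : Fin d) :
    correlation P t w ψ u = ∫ x, (clampedNetwork P t w j 0 x * ∫ z, ψ (z * inner ℝ u (w j)
          + inner ℝ (u - (inner ℝ u (w j) : ℝ) • w j) x) ∂(gaussianReal 0 1)
        + jump P t w j x * ∫ z, sgnAct t z * ψ (z * inner ℝ u (w j)
          + inner ℝ (u - (inner ℝ u (w j) : ℝ) • w j) x) ∂(gaussianReal 0 1))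
      ∂(stdGaussian (Inputs n)) := by
  rw [correlation, integral_stdGaussian_resample (hw.1 j) (measurable_network_mul hψm u)
    (abs_network_mul_le hP hψ u)]
  congr 1
  ext x
  simp_rw [network_resample P t hw, inner_resample]
  rw [← integral_const_mul, ← integral_const_mul, ← integral_add]
  · congr 1; ext z; ring
  · refine Integrable.const_mul (Integrable.of_bound
      (hψm.comp (by fun_prop)).aestronglyMeasurable 1 (.of_forall fun z => hψ _)) _
  · refine Integrable.const_mul (Integrable.of_bound
      ((measurable_sgnAct t).mul (hψm.comp (by fun_prop))).aestronglyMeasurable 1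
      (.of_forall fun z => ?_)) _
    rw [Pi.mul_apply, norm_mul]
    exact mul_le_one₀ (abs_sgnAct_le_one t z) (norm_nonneg _) (hψ _)

lemma integrable_clampedNetwork (hP : BoundedOnCube P B) (j : Fin d) {b : ℝ}
    (hb : b = 0 ∨ b = 1) : Integrable (clampedNetwork P t w j b) (stdGaussian (Inputs n)) :=
  Integrable.of_bound (measurable_clampedNetwork P t w j b).aestronglyMeasurable B
    (.of_forall fun x => abs_clampedNetwork_le hP j hb x)

lemma integrable_jump (hP : BoundedOnCube P B) (j : Fin d) :
    Integrable (jump P t w j) (stdGaussian (Inputs n)) :=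
  (integrable_clampedNetwork hP j (Or.inr rfl)).sub (integrable_clampedNetwork hP j (Or.inl rfl))

/-- In the direction of a weight vector the correlation sees only the expected jump of its unit
and the mean of the network with that unit switched off. -/
lemma correlation_weight (hP : BoundedOnCube P B) (hw : Orthonormal ℝ w)
    (hψm : Measurable ψ) (hψ : ∀ s, |ψ s| ≤ 1) (j : Fin d) :
    correlation P t w ψ (w j)
      = (∫ x, clampedNetwork P t w j 0 x ∂(stdGaussian (Inputs n)))
          * (∫ z, ψ z ∂(gaussianReal 0 1))
        + (∫ x, jump P t w j x ∂(stdGaussian (Inputs n)))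
          * ∫ z, sgnAct t z * ψ z ∂(gaussianReal 0 1) := by
  rw [correlation_eq_resample hP hw hψm hψ (w j) j]
  simp only [real_inner_self_eq_norm_sq, hw.1 j, one_pow, one_smul, sub_self, inner_zero_left,
    mul_one, add_zero]
  rw [integral_add ((integrable_clampedNetwork hP j (Or.inl rfl)).mul_const _)
    ((integrable_jump hP j).mul_const _), integral_mul_const, integral_mul_const]

lemma abs_integral_clampedNetwork_le (hP : BoundedOnCube P B) (j : Fin d) :
    |∫ x, clampedNetwork P t w j 0 x ∂(stdGaussian (Inputs n))| ≤ B := by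
  have := norm_integral_le_of_norm_le_const (μ := stdGaussian (Inputs n))
    (f := clampedNetwork P t w j 0)
    (.of_forall fun x => abs_clampedNetwork_le (t := t) (w := w) hP j (Or.inl rfl) x)
  simpa using this

/-- The bump of width `h` around the threshold `t`. -/
noncomputable def thresholdBump (t h s : ℝ) : ℝ := bump ((s - t) / h)

lemma continuous_thresholdBump (t h : ℝ) : Continuous (thresholdBump t h) :=
  continuous_bump.comp (by fun_prop)

lemma abs_thresholdBump_le_one (t h s : ℝ) : |thresholdBump t h s| ≤ 1 := abs_bump_le_one _

lemma abs_thresholdBump_sub_le (t : ℝ) {h : ℝ} (hh : 0 < h) (r s : ℝ) :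
    |thresholdBump t h r - thresholdBump t h s| ≤ 1 / h * |r - s| := by
  refine (abs_bump_sub_le _ _).trans (le_of_eq ?_)
  rw [← sub_div, abs_div, abs_of_pos hh, sub_sub_sub_cancel_right]
  ring

lemma thresholdBump_affine {t h a : ℝ} (hh : h ≠ 0) (ha : a ≠ 0) (y z : ℝ) :
    thresholdBump t h (z * a + y) = bump (a / h * (z - (t - y) / a)) := by
  rw [thresholdBump]
  congr 1
  field_simp
  ring

lemma le_correlation_thresholdBump (hP : BoundedOnCube P B) (hw : Orthonormal ℝ w) {h : ℝ}
    (hh : 0 < h) {ε : ℝ} {j : Fin d} (hε : 0 ≤ ε)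
    (hjump : ε ≤ ∫ x, jump P t w j x ∂(stdGaussian (Inputs n)))
    (hht : h ≤ gaussianPDFReal 0 1 t) :
    ε * (h * (gaussianPDFReal 0 1 t - h) / 6) - B * (2 * h ^ 2)
      ≤ correlation P t w (thresholdBump t h) (w j) := by
  rw [correlation_weight hP hw (continuous_thresholdBump t h).measurable
    (abs_thresholdBump_le_one t h) j]
  have hform : ∀ z, thresholdBump t h z = bump (1 / h * (z - t)) := fun z => by
    rw [thresholdBump]; congr 1; ring
  simp_rw [hform]
  have h1 := abs_integral_bump_le (k := 1 / h) (by positivity) t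
  have h2 := le_integral_sgnAct_bump (k := 1 / h) (by positivity) t
  have e1 : 2 / (1 / h) ^ 2 = 2 * h ^ 2 := by field_simp
  have e2 : (gaussianPDFReal 0 1 t - 1 / (1 / h)) / (6 * (1 / h))
      = h * (gaussianPDFReal 0 1 t - h) / 6 := by field_simp
  rw [e1] at h1
  rw [e2] at h2
  have h3 : ε * (h * (gaussianPDFReal 0 1 t - h) / 6)
      ≤ (∫ x, jump P t w j x ∂(stdGaussian (Inputs n)))
        * ∫ z, sgnAct t z * bump (1 / h * (z - t)) ∂(gaussianReal 0 1) :=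
    mul_le_mul hjump h2 (div_nonneg (mul_nonneg hh.le (by linarith)) (by norm_num))
      (hε.trans hjump)
  have h4 : |(∫ x, clampedNetwork P t w j 0 x ∂(stdGaussian (Inputs n)))
      * ∫ z, bump (1 / h * (z - t)) ∂(gaussianReal 0 1)| ≤ B * (2 * h ^ 2) := by
    rw [abs_mul]
    exact mul_le_mul (abs_integral_clampedNetwork_le hP j) h1 (abs_nonneg _) hP.nonneg
  linarith [(abs_le.1 h4).1]

lemma le_correlation_oddWeight (hP : BoundedOnCube P B) (hw : Orthonormal ℝ w) {ε : ℝ} {j : Fin d}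
    (hε : 0 ≤ ε) (hjump : ε ≤ ∫ x, jump P t w j x ∂(stdGaussian (Inputs n))) :
    ε * gaussianPDFReal 0 1 t ^ 2 ≤ correlation P t w oddWeight (w j) := by
  rw [correlation_weight hP hw continuous_oddWeight.measurable abs_oddWeight_le_one j,
    integral_oddWeight, mul_zero, zero_add]
  exact mul_le_mul hjump (le_integral_sgnAct_oddWeight t) (sq_nonneg _) (hε.trans hjump)

/-- Anti-concentration: a Gaussian slab of width `2 * h` has probability `O(h)`. -/
lemma stdGaussian_slab_le {v : Inputs n} (hv : v ≠ 0) (c : ℝ) {h : ℝ} (hh : 0 < h) :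
    (stdGaussian (Inputs n)).real {x | |((inner ℝ v x : ℝ) - c) / h| ≤ 1} ≤ 2 * h / ‖v‖ := by
  have hv' : 0 < ‖v‖ := norm_pos_iff.2 hv
  set S : Set (Inputs n) := {x | |((inner ℝ v x : ℝ) - c) / h| ≤ 1}
  have hS : MeasurableSet S := by
    apply measurableSet_le <;> fun_prop
  have he : ‖(‖v‖⁻¹ : ℝ) • v‖ = 1 := by
    rw [norm_smul, norm_inv, norm_norm, inv_mul_cancel₀ hv'.ne']
  have hve : (inner ℝ v ((‖v‖⁻¹ : ℝ) • v) : ℝ) = ‖v‖ := by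
    rw [inner_smul_right, real_inner_self_eq_norm_sq]
    field_simp
  have hk : ‖v‖ / h ≠ 0 := by positivity
  have hind : ∀ (x : Inputs n) (z : ℝ),
      S.indicator (1 : Inputs n → ℝ) (resample ((‖v‖⁻¹ : ℝ) • v) z x)
        = (bumpInterval (‖v‖ / h) (c / ‖v‖)).indicator (1 : ℝ → ℝ) z := fun x z => by
    refine Set.indicator_eq_indicator ?_ rfl
    rw [mem_bumpInterval_iff hk, Set.mem_ofPred_eq, inner_resample, hve, smul_smul,
      mul_inv_cancel₀ hv'.ne', one_smul, sub_self, inner_zero_left, add_zero]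
    have : (z * ‖v‖ - c) / h = ‖v‖ / h * (z - c / ‖v‖) := by field_simp
    rw [this]
  rw [← integral_indicator_one hS, integral_stdGaussian_resample he
    (measurable_one.indicator hS) (B := 1) (fun x => ?_)]
  · simp_rw [hind]
    rw [integral_const, probReal_univ, one_smul,
      integral_indicator_one (show MeasurableSet (bumpInterval _ _) from measurableSet_Icc)]
    refine (gaussianReal_real_bumpInterval_le _ _).trans (le_of_eq ?_)
    rw [abs_of_pos (by positivity)]
    field_simp
  · by_cases hx : x ∈ S <;> simp [hx]

/-- A direction that makes an intermediate angle with some weight vector has a small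
correlation: given the other coordinates, the two halves of the bump cancel unless the threshold
of the unit meets the bump, which is itself unlikely. -/
lemma abs_correlation_thresholdBump_le_of_inner (hP : BoundedOnCube P B) (hw : Orthonormal ℝ w)
    {h η : ℝ} (hh : 0 < h) (hη : 0 < η) {u : Inputs n} (hu : ‖u‖ = 1) {j : Fin d}
    (h1 : η ≤ |(inner ℝ u (w j) : ℝ)|) (h2 : η ^ 2 ≤ 1 - (inner ℝ u (w j) : ℝ) ^ 2) :
    |correlation P t w (thresholdBump t h) u| ≤ 14 * B * h ^ 2 / η ^ 2 := by
  have hB := hP.nonneg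
  rw [correlation_eq_resample hP hw (continuous_thresholdBump t h).measurable
    (abs_thresholdBump_le_one t h) u j]
  set a : ℝ := inner ℝ u (w j) with ha
  set v : Inputs n := u - a • w j with hv
  have ha0 : a ≠ 0 := abs_pos.1 (hη.trans_le h1)
  have hvn : ‖v‖ ^ 2 = 1 - a ^ 2 := by
    rw [hv, norm_sub_sq_real, norm_smul, inner_smul_right, hu, hw.1 j, ← ha, Real.norm_eq_abs,
      mul_one, sq_abs]
    ring
  have hvη : η ≤ ‖v‖ := by
    rw [← hvn] at h2
    exact (sq_le_sq₀ hη.le (norm_nonneg _)).1 h2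
  have hv0 : v ≠ 0 := norm_pos_iff.1 (hη.trans_le hvη)
  have hk : a / h ≠ 0 := div_ne_zero ha0 hh.ne'
  have hk2 : 2 / (a / h) ^ 2 ≤ 2 * h ^ 2 / η ^ 2 := by
    rw [div_pow, div_div_eq_mul_div]
    have : η ^ 2 ≤ a ^ 2 := by rw [← sq_abs a]; gcongr
    gcongr
  have hk1 : 2 / |a / h| ≤ 2 * h / η := by
    rw [abs_div, abs_of_pos hh, div_div_eq_mul_div]
    gcongr
  set bad : Set (Inputs n) := {x | |((inner ℝ v x : ℝ) - (t - a * t)) / h| ≤ 1} with hbad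
  have hbadm : MeasurableSet bad := by
    apply measurableSet_le <;> fun_prop
  have hbadI : Integrable (bad.indicator (1 : Inputs n → ℝ)) (stdGaussian (Inputs n)) :=
    (integrable_const (1 : ℝ)).indicator hbadm
  have hbadP : (stdGaussian (Inputs n)).real bad ≤ 2 * h / η :=
    (stdGaussian_slab_le hv0 _ hh).trans (by gcongr)
  rw [← Real.norm_eq_abs]
  refine (norm_integral_le_of_norm_le
    (g := fun x => 6 * B * h ^ 2 / η ^ 2 + bad.indicator (1 : Inputs n → ℝ) x * (4 * B * h / η))
    ((integrable_const _).add (hbadI.mul_const _)) (.of_forall fun x => ?_)).trans ?_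
  · simp_rw [thresholdBump_affine hh.ne' ha0]
    have hI0 := (abs_integral_bump_le hk ((t - inner ℝ v x) / a)).trans hk2
    have hI1 : |∫ z, sgnAct t z * bump (a / h * (z - (t - inner ℝ v x) / a)) ∂(gaussianReal 0 1)|
        ≤ 2 * h ^ 2 / η ^ 2 + bad.indicator (1 : Inputs n → ℝ) x * (2 * h / η) := by
      by_cases hx : x ∈ bad
      · rw [Set.indicator_of_mem hx, Pi.one_apply, one_mul]
        have := (abs_integral_sgnAct_bump_le hk t ((t - inner ℝ v x) / a)).trans hk1
        have : 0 ≤ 2 * h ^ 2 / η ^ 2 := by positivity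
        linarith
      · rw [Set.indicator_of_notMem hx, zero_mul, add_zero]
        refine (abs_integral_sgnAct_bump_le_of_lt hk ?_).trans hk2
        rw [hbad, Set.mem_ofPred_eq, not_le] at hx
        refine hx.trans_le (le_of_eq ?_)
        congr 1
        field_simp
        ring
    have hc := abs_clampedNetwork_le (t := t) (w := w) hP j (Or.inl rfl) x
    have hj := abs_jump_le (t := t) (w := w) hP j x
    refine (norm_add_le _ _).trans ?_
    rw [norm_mul, norm_mul]
    refine (add_le_add (mul_le_mul hc hI0 (abs_nonneg _) hB)
      (mul_le_mul hj hI1 (abs_nonneg _) (by positivity))).trans (le_of_eq ?_)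
    ring
  · rw [integral_add (integrable_const _) (hbadI.mul_const _), integral_mul_const,
      integral_indicator_one hbadm, integral_const, probReal_univ, one_smul]
    calc 6 * B * h ^ 2 / η ^ 2 + (stdGaussian (Inputs n)).real bad * (4 * B * h / η)
        ≤ 6 * B * h ^ 2 / η ^ 2 + 2 * h / η * (4 * B * h / η) := by gcongr
      _ = 14 * B * h ^ 2 / η ^ 2 := by field_simp; ring

/-- A direction nearly orthogonal to all weight vectors has a small correlation: the network does
not depend on the large component of the direction orthogonal to the weights. -/
lemma abs_correlation_thresholdBump_le_of_sum (hP : BoundedOnCube P B) (hw : Orthonormal ℝ w)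
    {h : ℝ} (hh : 0 < h) {u : Inputs n} (hu : ‖u‖ = 1)
    (hsum : ∑ j, (inner ℝ (w j) u : ℝ) ^ 2 ≤ 1 / 2) :
    |correlation P t w (thresholdBump t h) u| ≤ 4 * B * h ^ 2 := by
  have hB := hP.nonneg
  set r : Inputs n := u - ∑ j, (inner ℝ (w j) u : ℝ) • w j with hr
  have hwr : ∀ j, (inner ℝ (w j) r : ℝ) = 0 := fun j => by
    rw [hr, inner_sub_right, hw.inner_right_fintype, sub_self]
  have hur : (inner ℝ u r : ℝ) = 1 - ∑ j, (inner ℝ (w j) u : ℝ) ^ 2 := by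
    rw [hr, inner_sub_right, real_inner_self_eq_norm_sq, hu, inner_sum, one_pow]
    congr 1
    refine Finset.sum_congr rfl fun j _ => ?_
    rw [inner_smul_right, real_inner_comm, sq]
  have hrr : (inner ℝ u r : ℝ) = ‖r‖ ^ 2 := by
    rw [← real_inner_self_eq_norm_sq]
    conv_rhs => rw [hr, inner_sub_left, sum_inner]
    simp [inner_smul_left, hwr, ← hr]
  have hr2 : 1 / 2 ≤ ‖r‖ ^ 2 := by rw [← hrr, hur]; linarith
  have hr0 : 0 < ‖r‖ := by
    rcases (norm_nonneg r).eq_or_lt with h0 | h0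
    · rw [← h0] at hr2; norm_num at hr2
    · exact h0
  set e : Inputs n := (‖r‖⁻¹ : ℝ) • r with hedef
  have he : ‖e‖ = 1 := by
    rw [hedef, norm_smul, norm_inv, norm_norm, inv_mul_cancel₀ hr0.ne']
  have hue : (inner ℝ u e : ℝ) = ‖r‖ := by
    rw [hedef, inner_smul_right, hrr]
    field_simp
  have hnet : ∀ z x, network P t w (resample e z x) = network P t w x := fun z x => by
    unfold network
    refine congrArg (fun v => MvPolynomial.eval v P) (funext fun k => ?_)
    refine hiddenLayer_resample_of_inner_eq_zero t ?_ z x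
    rw [hedef, inner_smul_right, hwr, mul_zero]
  rw [correlation, integral_stdGaussian_resample he
    (measurable_network_mul (continuous_thresholdBump t h).measurable u)
    (abs_network_mul_le hP (abs_thresholdBump_le_one t h) u), ← Real.norm_eq_abs]
  refine (norm_integral_le_of_norm_le_const (C := 4 * B * h ^ 2) (.of_forall fun x => ?_)).trans
    (by simp)
  simp_rw [hnet, inner_resample, hue, thresholdBump_affine hh.ne' hr0.ne']
  rw [integral_const_mul, norm_mul]
  have hI := abs_integral_bump_le (k := ‖r‖ / h) (by positivity)
    ((t - inner ℝ (u - ‖r‖ • e) x) / ‖r‖)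
  have hk : 2 / (‖r‖ / h) ^ 2 ≤ 4 * h ^ 2 := by
    rw [div_pow, div_div_eq_mul_div, div_le_iff₀ (by positivity)]
    nlinarith [sq_nonneg h]
  refine (mul_le_mul (abs_network_le hP x) (hI.trans hk) (abs_nonneg _) hB).trans (le_of_eq ?_)
  ring

end Correlation

/-! ### Uniform concentration of empirical means -/

section Concentration

variable {Ω : Type*} [MeasurableSpace Ω]

lemma measureReal_le_sum_le_exp {ν : Measure Ω} [IsProbabilityMeasure ν] {q : Ω → ℝ}
    (hq : Measurable q) {B : ℝ} (hB : ∀ x, |q x| ≤ B) {m : ℕ} (hm : 0 < m) {α : ℝ} (hα : 0 ≤ α) :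
    (Measure.pi fun _ : Fin m => ν).real {ω | m * α ≤ ∑ k, (q (ω k) - ∫ x, q x ∂ν)}
      ≤ Real.exp (-(m * α ^ 2 / (2 * B ^ 2))) := by
  have hsub : HasSubgaussianMGF (fun x => q x - ∫ x, q x ∂ν) ((‖B - -B‖₊ / 2) ^ 2) ν :=
    hasSubgaussianMGF_of_mem_Icc hq.aemeasurable (.of_forall fun x => abs_le.1 (hB x))
  have hind : iIndepFun (fun (k : Fin m) (ω : Fin m → Ω) => q (ω k) - ∫ x, q x ∂ν)
      (Measure.pi fun _ : Fin m => ν) :=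
    iIndepFun_pi (X := fun _ x => q x - ∫ x, q x ∂ν) fun _ => (hq.sub_const _).aemeasurable
  have hsubk : ∀ k ∈ (Finset.univ : Finset (Fin m)), HasSubgaussianMGF
      (fun ω : Fin m → Ω => q (ω k) - ∫ x, q x ∂ν) ((‖B - -B‖₊ / 2) ^ 2)
      (Measure.pi fun _ : Fin m => ν) := fun k _ => by
    refine HasSubgaussianMGF.of_map (X := fun x => q x - ∫ x, q x ∂ν)
      (measurable_pi_apply k).aemeasurable ?_
    rwa [(measurePreserving_eval (fun _ : Fin m => ν) k).map_eq]
  refine (HasSubgaussianMGF.measure_sum_ge_le_of_iIndepFun hind hsubk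
    (by positivity : 0 ≤ m * α)).trans (le_of_eq ?_)
  congr 1
  have hB2 : (((‖B - -B‖₊ / 2) ^ 2 : NNReal) : ℝ) = B ^ 2 := by
    push_cast
    rw [Real.norm_eq_abs, div_pow, sq_abs]
    ring
  have hm' : (m : ℝ) ≠ 0 := by positivity
  rw [Finset.sum_const, Finset.card_univ, Fintype.card_fin]
  push_cast at hB2 ⊢
  rw [nsmul_eq_mul, hB2]
  rcases eq_or_ne B 0 with rfl | hB0
  · simp
  · field_simp

/-- Hoeffding's inequality with a union bound over finitely many statistics. -/
lemma one_sub_le_measureReal_empirical {ν : Measure Ω} [IsProbabilityMeasure ν] {ι : Type*}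
    [Fintype ι] {q : ι → Ω → ℝ} (hq : ∀ i, Measurable (q i)) {B : ℝ}
    (hB : ∀ i x, |q i x| ≤ B) {m : ℕ} (hm : 0 < m) {α δ N : ℝ} (hα : 0 < α) (hδ : 0 < δ)
    (hN : 0 < N) (hcard : (Fintype.card ι : ℝ) ≤ N)
    (hmα : Real.log (2 * N / δ) ≤ m * α ^ 2 / (2 * B ^ 2)) :
    1 - δ ≤ (Measure.pi fun _ : Fin m => ν).real
      {ω | ∀ i, |(∑ k, q i (ω k)) / m - ∫ x, q i x ∂ν| < α} := by
  set π := Measure.pi fun _ : Fin m => ν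
  set good : Set (Fin m → Ω) := {ω | ∀ i, |(∑ k, q i (ω k)) / m - ∫ x, q i x ∂ν| < α}
  set r := Real.exp (-(m * α ^ 2 / (2 * B ^ 2)))
  set up : ι → Set (Fin m → Ω) := fun i => {ω | m * α ≤ ∑ k, (q i (ω k) - ∫ x, q i x ∂ν)}
  set dn : ι → Set (Fin m → Ω) := fun i => {ω | m * α ≤ ∑ k, (-q i (ω k) - ∫ x, -q i x ∂ν)}
  have hm' : (0 : ℝ) < m := by positivity
  have hcover : goodᶜ ⊆ ⋃ i, (up i ∪ dn i) := by
    intro ω hω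
    simp only [good, Set.mem_compl_iff, Set.mem_ofPred_eq, not_forall, not_lt] at hω
    obtain ⟨i, hi⟩ := hω
    refine Set.mem_iUnion.2 ⟨i, ?_⟩
    have hsum : (∑ k, q i (ω k)) / m - ∫ x, q i x ∂ν
        = (∑ k, (q i (ω k) - ∫ x, q i x ∂ν)) / m := by
      rw [Finset.sum_sub_distrib, Finset.sum_const, Finset.card_univ, Fintype.card_fin,
        nsmul_eq_mul]
      field_simp
    rw [hsum, abs_div, abs_of_pos hm', le_div_iff₀ hm', mul_comm] at hi
    rcases le_abs.1 hi with h | h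
    · exact Or.inl h
    · refine Or.inr (h.trans (le_of_eq ?_))
      rw [integral_neg, ← Finset.sum_neg_distrib]
      exact Finset.sum_congr rfl fun k _ => by ring
  have hbad : π.real goodᶜ ≤ δ := by
    have hr : r ≤ δ / (2 * N) := by
      have h1 : r ≤ Real.exp (-Real.log (2 * N / δ)) := Real.exp_le_exp.2 (neg_le_neg hmα)
      rwa [Real.exp_neg, Real.exp_log (by positivity), inv_div] at h1
    calc π.real goodᶜ ≤ π.real (⋃ i, (up i ∪ dn i)) := measureReal_mono hcover
      _ ≤ ∑ i, π.real (up i ∪ dn i) := measureReal_iUnion_fintype_le _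
      _ ≤ ∑ _i : ι, 2 * r := Finset.sum_le_sum fun i _ => by
          have h1 := measureReal_le_sum_le_exp (ν := ν) (hq i) (hB i) hm hα.le
          have h2 := measureReal_le_sum_le_exp (ν := ν) (q := fun x => -q i x) (hq i).neg
            (fun x => (abs_neg _).trans_le (hB i x)) hm hα.le
          have h3 : π.real (up i ∪ dn i) ≤ π.real (up i) + π.real (dn i) :=
            measureReal_union_le _ _
          exact h3.trans ((add_le_add h1 h2).trans (le_of_eq (two_mul _).symm))
      _ = Fintype.card ι * (2 * r) := by
          rw [Finset.sum_const, Finset.card_univ, nsmul_eq_mul]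
      _ ≤ N * (2 * (δ / (2 * N))) := by gcongr
      _ = δ := by field_simp
  have hone : 1 ≤ π.real good + π.real goodᶜ := by
    rw [← probReal_univ (μ := π), ← Set.union_compl_self good]
    exact measureReal_union_le _ _
  linarith

end Concentration

/-! ### A finite net of the unit sphere -/

lemma exists_sphere_net (n K : ℕ) {γ : ℝ} (hK : 0 < K) (hγ : (n : ℝ) / K ≤ γ) :
    ∃ N : Finset (Inputs n), (∀ u ∈ N, ‖u‖ = 1) ∧
      (∀ w : Inputs n, ‖w‖ = 1 → ∃ u ∈ N, ‖u - w‖ ≤ γ) ∧ N.card ≤ (2 * K + 1) ^ n := by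
  classical
  have hK' : (0 : ℝ) < K := by positivity
  -- directions are sorted into cells of a grid; the net picks one direction from each cell
  let round : Inputs n → Fin n → ℤ := fun w i => ⌊K * w i⌋
  let grid : Finset (Fin n → ℤ) := Fintype.piFinset fun _ => Finset.Icc (-(K : ℤ)) K
  let pick : (Fin n → ℤ) → Inputs n := fun k =>
    if h : ∃ w : Inputs n, ‖w‖ = 1 ∧ round w = k then h.choose else 0
  have hpick : ∀ k, (∃ w : Inputs n, ‖w‖ = 1 ∧ round w = k) → ‖pick k‖ = 1 ∧ round (pick k) = k :=
    fun k h => by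
      simp only [pick, dif_pos h]
      exact h.choose_spec
  refine ⟨(grid.filter fun k => ∃ w : Inputs n, ‖w‖ = 1 ∧ round w = k).image pick, ?_, ?_, ?_⟩
  · intro u hu
    obtain ⟨k, hk, rfl⟩ := Finset.mem_image.1 hu
    exact (hpick k (Finset.mem_filter.1 hk).2).1
  · intro w hw
    have hex : ∃ w' : Inputs n, ‖w'‖ = 1 ∧ round w' = round w := ⟨w, hw, rfl⟩
    refine ⟨pick (round w), Finset.mem_image_of_mem _ (Finset.mem_filter.2 ⟨?_, hex⟩), ?_⟩
    · refine Fintype.mem_piFinset.2 fun i => Finset.mem_Icc.2 ?_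
      have hi : |w i| ≤ 1 := hw ▸ PiLp.norm_apply_le w i
      obtain ⟨h1, h2⟩ := abs_le.1 hi
      constructor
      · rw [Int.le_floor]; push_cast; nlinarith
      · rw [← Int.cast_le (R := ℝ)]
        exact (Int.floor_le _).trans (by push_cast; nlinarith)
    · obtain ⟨-, hr⟩ := hpick _ hex
      refine le_trans ?_ hγ
      have hcoord : ∀ i, |(pick (round w) - w) i| ≤ 1 / K := fun i => by
        have h := Int.abs_sub_lt_one_of_floor_eq_floor (congrFun hr i)
        rw [← mul_sub, abs_mul, abs_of_pos hK'] at h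
        rw [PiLp.sub_apply, le_div_iff₀ hK', mul_comm]
        exact h.le
      refine abs_le_of_sq_le_sq' (a := ‖pick (round w) - w‖) ?_ (by positivity) |>.2
      rw [EuclideanSpace.real_norm_sq_eq]
      calc ∑ i, (pick (round w) - w) i ^ 2 ≤ ∑ _i : Fin n, (1 / (K : ℝ)) ^ 2 :=
            Finset.sum_le_sum fun i _ => by
              rw [← sq_abs]; exact pow_le_pow_left₀ (abs_nonneg _) (hcoord i) 2
        _ = n / (K : ℝ) ^ 2 := by
            rw [Finset.sum_const, Finset.card_univ, Fintype.card_fin, nsmul_eq_mul]; ring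
        _ ≤ (n / (K : ℝ)) ^ 2 := by
            rw [div_pow]
            have : (n : ℝ) ≤ (n : ℝ) ^ 2 := by exact_mod_cast Nat.le_self_pow two_ne_zero n
            gcongr
  · refine Finset.card_image_le.trans ((Finset.card_filter_le _ _).trans (le_of_eq ?_))
    rw [Fintype.card_piFinset_const, Int.card_Icc]
    congr 1
    omega

/-! ### Recovery of the weights from a set of accepted directions -/

section Recovery

variable {d n : ℕ}

lemma Orthonormal.norm_sub_sq {E ι : Type*} [NormedAddCommGroup E] [InnerProductSpace ℝ E]
    {w : ι → E} (hw : Orthonormal ℝ w) {i k : ι} (hik : i ≠ k) : ‖w i - w k‖ ^ 2 = 2 := by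
  rw [norm_sub_sq_real, hw.1 i, hw.1 k, hw.2 hik]; norm_num

/-- The vectors `v i` all lie in `A` and have pairwise distance at least `1`. -/
def IsSeparatedFamily (A : Set (Inputs n)) (v : Fin d → Inputs n) : Prop :=
  (∀ i, v i ∈ A) ∧ ∀ i k, i ≠ k → 1 ≤ ‖v i - v k‖

lemma exists_isSeparatedFamily {A : Set (Inputs n)} {w : Fin d → Inputs n} (hw : Orthonormal ℝ w)
    (hA : ∀ j, ∃ u ∈ A, ‖u - w j‖ ≤ 1 / 8) : ∃ v : Fin d → Inputs n, IsSeparatedFamily A v := by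
  choose v hvA hv using hA
  refine ⟨v, hvA, fun i k hik => ?_⟩
  have h2 := hw.norm_sub_sq hik
  have htri : ‖w i - w k‖ ≤ ‖v i - w i‖ + ‖v i - v k‖ + ‖v k - w k‖ := by
    have : w i - w k = -(v i - w i) + (v i - v k) + (v k - w k) := by abel
    rw [this]
    exact (norm_add_le _ _).trans (by gcongr; exact (norm_add_le _ _).trans (by rw [norm_neg]))
  nlinarith [hv i, hv k, norm_nonneg (w i - w k)]

lemma IsSeparatedFamily.entrywiseClose {A : Set (Inputs n)} {v w : Fin d → Inputs n}
    (hv : IsSeparatedFamily A v) {ρ : ℝ} (hρ : ρ < 1 / 2)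
    (hA : ∀ u ∈ A, ∃ j, ‖u - w j‖ ≤ ρ) : EntrywiseClose ρ v w := by
  choose f hf using fun i => hA (v i) (hv.1 i)
  have hinj : Function.Injective f := fun i k hik => by
    by_contra hne
    have h1 := hv.2 i k hne
    have h2 : ‖v i - v k‖ ≤ ‖v i - w (f i)‖ + ‖v k - w (f k)‖ := by
      rw [hik, ← norm_neg (v k - _)]
      refine le_trans (le_of_eq ?_) (norm_add_le _ _)
      congr 1; abel
    linarith [hf i, hf k]
  let σ : Equiv.Perm (Fin d) := Equiv.ofBijective f (Finite.injective_iff_bijective.1 hinj)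
  refine ⟨σ.symm, fun i j => ?_⟩
  have h := hf (σ.symm i)
  rw [show f (σ.symm i) = i from σ.apply_symm_apply i] at h
  exact (PiLp.norm_apply_le (v (σ.symm i) - w i) j).trans h

/-- A separated family of vectors in `A`, if there is one. -/
noncomputable def chooseSeparated (d : ℕ) (A : Set (Inputs n)) : Fin d → Inputs n :=
  open Classical in
  if h : ∃ v : Fin d → Inputs n, IsSeparatedFamily A v then h.choose else 0

lemma isSeparatedFamily_chooseSeparated {A : Set (Inputs n)}
    (h : ∃ v : Fin d → Inputs n, IsSeparatedFamily A v) :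
    IsSeparatedFamily A (chooseSeparated d A) := by
  rw [chooseSeparated, dif_pos h]
  exact h.choose_spec

/-- The correlation of the labels with the test function `ψ` in direction `u` over a sample. -/
noncomputable def empiricalCorrelation {m : ℕ} (ψ : ℝ → ℝ) (u : Inputs n)
    (s : Fin m → Inputs n × ℝ) : ℝ :=
  (∑ k, (s k).2 * ψ (inner ℝ u (s k).1)) / m

lemma measurable_empiricalCorrelation {m : ℕ} {ψ : ℝ → ℝ} (hψ : Measurable ψ) (u : Inputs n) :
    Measurable (empiricalCorrelation (m := m) ψ u) := by
  refine (Finset.measurable_sum _ fun k _ => ?_).div_const _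
  exact (measurable_snd.comp (measurable_pi_apply k)).mul
    (hψ.comp (by fun_prop))

/-- The directions of the net `N` that look like a weight vector on the sample: the correlation
with the bump at the threshold `t` is large, and the correlation with `oddWeight`, which tells a
weight vector from its negative, is nonnegative. -/
def acceptedDirections {m : ℕ} (N : Finset (Inputs n)) (t h θ : ℝ)
    (s : Fin m → Inputs n × ℝ) : Set (Inputs n) :=
  {u | u ∈ N ∧ θ ≤ empiricalCorrelation (thresholdBump t h) u s ∧
    0 ≤ empiricalCorrelation oddWeight u s}

/-- The learner: a separated family of accepted directions. -/
noncomputable def netLearner {m : ℕ} (d : ℕ) (N : Finset (Inputs n)) (t h θ : ℝ)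
    (s : Fin m → Inputs n × ℝ) : Fin d → Inputs n :=
  chooseSeparated d (acceptedDirections N t h θ s)

lemma measurable_netLearner {m : ℕ} (d : ℕ) (N : Finset (Inputs n)) (t h θ : ℝ) :
    Measurable (netLearner (m := m) d N t h θ) := by
  -- the output depends on the sample only through the set of accepted directions of the finite net
  let accept : (Fin m → Inputs n × ℝ) → Set N := fun s => {u | (u : Inputs n) ∈
    acceptedDirections N t h θ s}
  have haccept : Measurable accept := by
    refine measurable_set_iff.2 fun u => ?_
    have h1 := measurable_empiricalCorrelation (m := m)
      (continuous_thresholdBump t h).measurable (u : Inputs n)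
    have h2 := measurable_empiricalCorrelation (m := m)
      continuous_oddWeight.measurable (u : Inputs n)
    have hset : MeasurableSet {s : Fin m → Inputs n × ℝ | u ∈ accept s} := by
      have : {s : Fin m → Inputs n × ℝ | u ∈ accept s}
          = {s | θ ≤ empiricalCorrelation (thresholdBump t h) (u : Inputs n) s}
            ∩ {s | 0 ≤ empiricalCorrelation oddWeight (u : Inputs n) s} := by
        ext s
        simp [accept, acceptedDirections]
      rw [this]
      exact (measurableSet_le measurable_const h1).inter (measurableSet_le measurable_const h2)
    exact measurableSet_setOfPred.1 hset
  have hfactor : netLearner (m := m) d N t h θ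
      = (fun S : Set N => chooseSeparated d (Subtype.val '' S)) ∘ accept := by
    ext1 s
    rw [netLearner, Function.comp_apply]
    congr 1
    ext u
    constructor
    · intro hu; exact ⟨⟨u, hu.1⟩, hu, rfl⟩
    · rintro ⟨u', hu', rfl⟩; exact hu'
  rw [hfactor]
  exact (measurable_of_finite _).comp haccept

end Recovery

/-! ### Correctness of the learner -/

section Learner

variable {d n : ℕ} {P : MvPolynomial (Fin d) ℝ} {t B : ℝ} {w : Fin d → Inputs n}

lemma norm_sub_sq_le_of_inner {u v : Inputs n} (hu : ‖u‖ = 1) (hv : ‖v‖ = 1) {η : ℝ}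
    (hpos : 0 ≤ (inner ℝ u v : ℝ)) (h : 1 - (inner ℝ u v : ℝ) ^ 2 ≤ η ^ 2) :
    ‖u - v‖ ^ 2 ≤ 2 * η ^ 2 := by
  have h1 : (inner ℝ u v : ℝ) ≤ 1 := by simpa [hu, hv] using real_inner_le_norm u v
  rw [norm_sub_sq_real, hu, hv]
  nlinarith

/-- A direction whose correlation with the threshold bump is not small is close to a weight vector
or to the negative of one. -/
lemma exists_norm_sub_le_or_norm_add_le (hP : BoundedOnCube P B) (hw : Orthonormal ℝ w)
    {h η : ℝ} (hh : 0 < h) (hη : 0 < η) (hη1 : η ≤ 1 / 2) (hηd : d * η ^ 2 ≤ 1 / 2)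
    {u : Inputs n} (hu : ‖u‖ = 1)
    (hlarge : 14 * B * h ^ 2 / η ^ 2 < correlation P t w (thresholdBump t h) u) :
    ∃ j, ‖u - w j‖ ≤ 2 * η ∨ ‖u + w j‖ ≤ 2 * η := by
  have hB := hP.nonneg
  have hangle : ∀ j, η ≤ |(inner ℝ u (w j) : ℝ)| → 1 - (inner ℝ u (w j) : ℝ) ^ 2 < η ^ 2 :=
    fun j hj => by
      by_contra hcon
      exact absurd ((le_abs_self _).trans (abs_correlation_thresholdBump_le_of_inner hP hw hh hη hu
        hj (not_lt.1 hcon))) (not_le.2 hlarge)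
  have hsq : ∀ x : ℝ, x ^ 2 ≤ 2 * η ^ 2 → x ≤ 2 * η := fun x hx => by nlinarith
  by_cases hex : ∃ j, η ≤ |(inner ℝ u (w j) : ℝ)|
  · obtain ⟨j, hj⟩ := hex
    refine ⟨j, ?_⟩
    rcases le_total 0 (inner ℝ u (w j) : ℝ) with h0 | h0
    · exact Or.inl (hsq _ (norm_sub_sq_le_of_inner hu (hw.1 j) h0 (hangle j hj).le))
    · refine Or.inr (hsq _ ?_)
      rw [← sub_neg_eq_add]
      refine norm_sub_sq_le_of_inner hu (by rw [norm_neg, hw.1 j]) ?_ ?_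
      · rw [inner_neg_right]; linarith
      · rw [inner_neg_right, neg_sq]; exact (hangle j hj).le
  · push Not at hex
    have hsum : ∑ j, (inner ℝ (w j) u : ℝ) ^ 2 ≤ 1 / 2 := by
      calc ∑ j, (inner ℝ (w j) u : ℝ) ^ 2 ≤ ∑ _j : Fin d, η ^ 2 :=
            Finset.sum_le_sum fun j _ => by
              rw [real_inner_comm, ← sq_abs]
              exact pow_le_pow_left₀ (abs_nonneg _) (hex j).le 2
        _ = d * η ^ 2 := by
            rw [Finset.sum_const, Finset.card_univ, Fintype.card_fin, nsmul_eq_mul]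
        _ ≤ 1 / 2 := hηd
    have hsmall := (le_abs_self _).trans
      (abs_correlation_thresholdBump_le_of_sum (t := t) hP hw hh hu hsum)
    have hle : 4 * B * h ^ 2 ≤ 14 * B * h ^ 2 / η ^ 2 := by
      rw [le_div_iff₀ (by positivity)]
      have hη2 : η ^ 2 ≤ 1 := by nlinarith
      have : 0 ≤ B * h ^ 2 := by positivity
      nlinarith
    linarith

lemma empiricalCorrelation_labelledSample {m : ℕ} (ψ : ℝ → ℝ) (u : Inputs n)
    (ω : Fin m → Inputs n) :
    empiricalCorrelation ψ u (labelledSample P t w ω)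
      = (∑ k, network P t w (ω k) * ψ (inner ℝ u (ω k))) / m := rfl

/-- If the empirical correlations over the net are accurate, the learner succeeds. -/
lemma entrywiseClose_netLearner (hP : BoundedOnCube P B) (hw : Orthonormal ℝ w) {m : ℕ}
    {N : Finset (Inputs n)} (hN1 : ∀ u ∈ N, ‖u‖ = 1) {γ h η θ α ε : ℝ}
    (hN : ∀ v : Inputs n, ‖v‖ = 1 → ∃ u ∈ N, ‖u - v‖ ≤ γ)
    (hh : 0 < h) (hγ : γ ≤ 1 / 8) (hη : 0 < η) (hη1 : 2 * η < 1 / 2)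
    (hηd : d * η ^ 2 ≤ 1 / 2) (hε : 0 ≤ ε) (hht : h ≤ gaussianPDFReal 0 1 t)
    (hjump : ∀ j, ε ≤ ∫ x, jump P t w j x ∂(stdGaussian (Inputs n)))
    (hfar : 14 * B * h ^ 2 / η ^ 2 + α < θ)
    (hnear : θ + α + B * (1 / h) * γ
      ≤ ε * (h * (gaussianPDFReal 0 1 t - h) / 6) - B * (2 * h ^ 2))
    (hsign : α + 2 * B * η < ε * gaussianPDFReal 0 1 t ^ 2)
    (hsign' : α + B * γ ≤ ε * gaussianPDFReal 0 1 t ^ 2)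
    {s : Fin m → Inputs n × ℝ}
    (hbump : ∀ u ∈ N, |empiricalCorrelation (thresholdBump t h) u s
      - correlation P t w (thresholdBump t h) u| < α)
    (hodd : ∀ u ∈ N, |empiricalCorrelation oddWeight u s - correlation P t w oddWeight u| < α) :
    EntrywiseClose (2 * η) (netLearner d N t h θ s) w := by
  have hB := hP.nonneg
  have hS := abs_correlation_sub_le (P := P) (t := t) (w := w) hP
    (continuous_thresholdBump t h).measurable (abs_thresholdBump_le_one t h)
    (abs_thresholdBump_sub_le t hh)
  have hT := abs_correlation_sub_le (P := P) (t := t) (w := w) hP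
    continuous_oddWeight.measurable abs_oddWeight_le_one (L := 1)
    (fun r s => by rw [one_mul]; exact abs_oddWeight_sub_le r s)
  have hTw := fun j => le_correlation_oddWeight (t := t) hP hw hε (hjump j)
  -- points of the net near a weight vector are accepted
  have hacc : ∀ j, ∃ u ∈ acceptedDirections N t h θ s, ‖u - w j‖ ≤ 1 / 8 := fun j => by
    obtain ⟨u, huN, hu⟩ := hN (w j) (hw.1 j)
    refine ⟨u, ⟨huN, ?_, ?_⟩, hu.trans hγ⟩
    · have h1 := le_correlation_thresholdBump hP hw hh hε (hjump j) hht
      have h2 : B * (1 / h) * ‖u - w j‖ ≤ B * (1 / h) * γ := by gcongr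
      have h3 := (abs_le.1 ((hS u (w j)).trans h2)).1
      have h4 := (abs_lt.1 (hbump u huN)).1
      linarith
    · have h2 : B * 1 * ‖u - w j‖ ≤ B * 1 * γ := by gcongr
      have h3 := (abs_le.1 ((hT u (w j)).trans h2)).1
      have h4 := (abs_lt.1 (hodd u huN)).1
      linarith [hTw j]
  -- accepted points are near a weight vector; its negative is ruled out by the odd weight
  have hclose : ∀ u ∈ acceptedDirections N t h θ s, ∃ j, ‖u - w j‖ ≤ 2 * η := by
    rintro u ⟨huN, h1, h2⟩
    have h3 := (abs_lt.1 (hbump u huN)).2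
    obtain ⟨j, hj | hj⟩ := exists_norm_sub_le_or_norm_add_le (t := t) hP hw hh hη (by linarith)
      hηd (hN1 u huN) (by linarith)
    · exact ⟨j, hj⟩
    · exfalso
      have h4 : B * 1 * ‖u - -w j‖ ≤ B * 1 * (2 * η) := by
        rw [sub_neg_eq_add]; gcongr
      have h5 := (abs_le.1 ((hT u (-w j)).trans h4)).2
      rw [correlation_neg oddWeight_neg] at h5
      have h6 := (abs_lt.1 (hodd u huN)).2
      linarith [hTw j]
  exact (isSeparatedFamily_chooseSeparated (exists_isSeparatedFamily hw hacc)).entrywiseClose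
    hη1 hclose

lemma one_sub_le_measureReal_netLearner (hP : BoundedOnCube P B) (hw : Orthonormal ℝ w) {m : ℕ}
    (hm : 0 < m) {N : Finset (Inputs n)} (hN1 : ∀ u ∈ N, ‖u‖ = 1) {γ h η θ α ε δ Q : ℝ}
    (hN : ∀ v : Inputs n, ‖v‖ = 1 → ∃ u ∈ N, ‖u - v‖ ≤ γ)
    (hh : 0 < h) (hγ : γ ≤ 1 / 8) (hη : 0 < η) (hη1 : 2 * η < 1 / 2)
    (hηd : d * η ^ 2 ≤ 1 / 2) (hε : 0 ≤ ε) (hht : h ≤ gaussianPDFReal 0 1 t)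
    (hjump : ∀ j, ε ≤ ∫ x, jump P t w j x ∂(stdGaussian (Inputs n)))
    (hfar : 14 * B * h ^ 2 / η ^ 2 + α < θ)
    (hnear : θ + α + B * (1 / h) * γ
      ≤ ε * (h * (gaussianPDFReal 0 1 t - h) / 6) - B * (2 * h ^ 2))
    (hsign : α + 2 * B * η < ε * gaussianPDFReal 0 1 t ^ 2)
    (hsign' : α + B * γ ≤ ε * gaussianPDFReal 0 1 t ^ 2)
    (hα : 0 < α) (hδ : 0 < δ) (hQ : 0 < Q) (hcard : (2 * N.card : ℝ) ≤ Q)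
    (hmα : Real.log (2 * Q / δ) ≤ m * α ^ 2 / (2 * B ^ 2)) :
    1 - δ ≤ (Measure.pi fun _ : Fin m => stdGaussian (Inputs n)).real
      {ω | EntrywiseClose (2 * η) (netLearner d N t h θ (labelledSample P t w ω)) w} := by
  -- two statistics for each direction of the net
  let ψ : Bool → ℝ → ℝ := fun b => if b then thresholdBump t h else oddWeight
  have hψm : ∀ b, Measurable (ψ b) := fun b => by
    cases b
    · exact continuous_oddWeight.measurable
    · exact (continuous_thresholdBump t h).measurable
  have hψ : ∀ b s, |ψ b s| ≤ 1 := fun b => by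
    cases b
    · exact abs_oddWeight_le_one
    · exact abs_thresholdBump_le_one t h
  let q : Bool × N → Inputs n → ℝ := fun i x => network P t w x * ψ i.1 (inner ℝ (i.2 : Inputs n) x)
  have hqm : ∀ i, Measurable (q i) := fun i => measurable_network_mul (hψm i.1) (i.2 : Inputs n)
  have hqB : ∀ i x, |q i x| ≤ B := fun i x => abs_network_mul_le hP (hψ i.1) (i.2 : Inputs n) x
  have hcard' : (Fintype.card (Bool × N) : ℝ) ≤ Q := by
    rw [Fintype.card_prod, Fintype.card_bool, Fintype.card_coe]
    exact_mod_cast hcard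
  have hconc := one_sub_le_measureReal_empirical (ν := stdGaussian (Inputs n)) hqm hqB hm hα hδ hQ
    hcard' hmα
  refine hconc.trans (measureReal_mono fun ω hω => ?_)
  have hstat : ∀ b, ∀ u ∈ N, |empiricalCorrelation (ψ b) u (labelledSample P t w ω)
      - correlation P t w (ψ b) u| < α := fun b u hu => by
    rw [empiricalCorrelation_labelledSample, correlation]
    exact hω (b, ⟨u, hu⟩)
  exact entrywiseClose_netLearner hP hw hN1 hN hh hγ hη hη1 hηd hε hht hjump hfar hnear hsign
    hsign' (hstat true) (hstat false)

end Learner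

/-! ### Choice of the parameters -/

/-- The expected jump exceeds `ε₃` once the coefficient condition holds. -/
lemma lt_integral_jump {d n : ℕ} {P : MvPolynomial (Fin d) ℝ} (hP : ∀ i, P.degreeOf i ≤ 1)
    {t ε μ : ℝ} {w : Fin d → Inputs n} (hw : Orthonormal ℝ w) {j : Fin d}
    (hμ : μ = ∫ x, hiddenLayer t w x j ∂(stdGaussian (Inputs n)))
    (hcoeff : ε * μ < MvPolynomial.coeff (Finsupp.single j 1) (shiftScale μ P)) :
    ε < ∫ x, jump P t w j x ∂(stdGaussian (Inputs n)) := by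
  have hμ' : μ = ∫ z, sgnAct t z ∂(gaussianReal 0 1) := by
    have := integral_prod_hiddenLayer t hw {j}
    simp only [Finset.prod_singleton, Finset.card_singleton, pow_one] at this
    rw [hμ, this]
  have hμ0 : 0 ≤ μ := by
    rw [hμ']
    refine integral_nonneg fun z => ?_
    rcases sgnAct_eq_zero_or_one t z with h | h <;> simp [h]
  have hmain := mul_integral_jump hP t hw j
  rw [← hμ'] at hmain
  rw [← hmain, mul_comm] at hcoeff
  exact lt_of_mul_lt_mul_left hcoeff hμ0

/-- The theorem with all problem parameters bounded by a single number `M`. -/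
lemma exists_learner_of_bounds {d n m : ℕ} {t ε δ M : ℝ} (hM : 1 ≤ M) (hn : (n : ℝ) ≤ M)
    (hd : (d : ℝ) ≤ M) (ht : 1 / M ≤ gaussianPDFReal 0 1 t) (hε : 1 / M ≤ ε) (hδ : 0 < δ)
    (hδ1 : δ < 1) (hm : 2 ^ 100 * M ^ 55 * Real.log (2 / δ) ≤ m) :
    ∃ learner : (Fin m → Inputs n × ℝ) → Fin d → Inputs n, Measurable learner ∧
      ∀ (w : Fin d → Inputs n) (P : MvPolynomial (Fin d) ℝ), Orthonormal ℝ w →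
        BoundedOnCube P M →
        (∀ j, 1 / M ≤ ∫ x, jump P t w j x ∂(stdGaussian (Inputs n))) →
        1 - δ ≤ (Measure.pi fun _ : Fin m => stdGaussian (Inputs n)).real
          {ω | EntrywiseClose ε (learner (labelledSample P t w ω)) w} := by
  have hM0 : 0 < M := by linarith
  have hℓ : 1 / 2 ≤ Real.log (2 / δ) := by
    have h1 : Real.log 2 ≤ Real.log (2 / δ) := by
      apply Real.log_le_log (by norm_num)
      rw [le_div_iff₀ hδ]; linarith
    linarith [Real.log_two_gt_d9]
  set ℓ := Real.log (2 / δ)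
  have hm0 : 0 < m := by
    have : (0 : ℝ) < m := lt_of_lt_of_le (by positivity) hm
    exact_mod_cast this
  -- everything is a power of `x = 1 / M`: `2 * η` is the accuracy of the output, `h` the width of
  -- the bump, `α` the statistical accuracy, `θ` the acceptance threshold, `γ` the mesh of the net
  set x : ℝ := 1 / M with hx
  have hMx : M = 1 / x := by rw [hx, one_div_one_div]
  have hx0 : 0 < x := by positivity
  have hx1 : x ≤ 1 := by rw [hx, div_le_one hM0]; exact hM
  have hpow : ∀ k l : ℕ, l ≤ k → x ^ k ≤ x ^ l := fun k l hkl =>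
    pow_le_pow_of_le_one hx0.le hx1 hkl
  have hdx : (d : ℝ) * x ≤ 1 := by
    rw [hx, mul_one_div, div_le_one hM0]; exact hd
  set K : ℕ := ⌈(2 : ℝ) ^ 43 * M ^ 26⌉₊ with hK
  have hKlow : (2 : ℝ) ^ 43 * M ^ 26 ≤ K := Nat.le_ceil _
  have hM26 : 1 ≤ M ^ 26 := one_le_pow₀ hM
  have hKup : (2 * K + 1 : ℝ) ≤ 2 ^ 46 * M ^ 26 := by
    have := (Nat.ceil_lt_add_one (a := (2 : ℝ) ^ 43 * M ^ 26) (by positivity)).le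
    rw [← hK] at this
    linarith
  have hK0 : 0 < K := by
    have : (0 : ℝ) < K := lt_of_lt_of_le (by positivity) hKlow
    exact_mod_cast this
  have hmesh : (n : ℝ) / K ≤ x ^ 25 / 2 ^ 43 := by
    calc (n : ℝ) / K ≤ M / (2 ^ 43 * M ^ 26) := by gcongr
      _ = x ^ 25 / 2 ^ 43 := by rw [hMx]; field_simp
  obtain ⟨N, hN1, hN, hNcard⟩ := exists_sphere_net n K hK0 hmesh
  have h13 := hpow 13 3 (by norm_num)
  have h3 : 0 < x ^ 3 := by positivity
  refine ⟨netLearner d N t (x ^ 11 / 2 ^ 18) (x ^ 13 / 2 ^ 23), measurable_netLearner _ _ _ _ _,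
    fun w P hw hP hjump => ?_⟩
  have hx2 : x * x ^ 2 ≤ x * gaussianPDFReal 0 1 t ^ 2 := by gcongr
  have hmain := one_sub_le_measureReal_netLearner (t := t) hP hw hm0 hN1 (h := x ^ 11 / 2 ^ 18)
    (η := x ^ 4 / 16) (θ := x ^ 13 / 2 ^ 23) (α := x ^ 13 / 2 ^ 25) (ε := x) (δ := δ)
    (Q := 2 * (2 * K + 1) ^ n) hN (by positivity)
    (by have := hpow 25 0 (by norm_num); linarith) (by positivity)
    (by have := hpow 4 0 (by norm_num); linarith)
    (by
      have h7 := hpow 7 0 (by norm_num)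
      calc (d : ℝ) * (x ^ 4 / 16) ^ 2 = (d * x) * (x ^ 7 / 256) := by ring
        _ ≤ 1 * (1 / 256) := by gcongr; simpa using h7
        _ ≤ 1 / 2 := by norm_num)
    hx0.le
    (by have := hpow 11 1 (by norm_num); linarith)
    hjump
    (by
      have e : 14 * M * (x ^ 11 / 2 ^ 18) ^ 2 / (x ^ 4 / 16) ^ 2 = 14 / 2 ^ 28 * x ^ 13 := by
        rw [hMx]; field_simp; norm_num
      rw [e]
      have : 0 < x ^ 13 := by positivity
      linarith)
    (by
      have e1 : M * (1 / (x ^ 11 / 2 ^ 18)) * (x ^ 25 / 2 ^ 43) = x ^ 13 / 2 ^ 25 := by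
        rw [hMx]; field_simp
      have e2 : M * (2 * (x ^ 11 / 2 ^ 18) ^ 2) = x ^ 21 / 2 ^ 35 := by
        rw [hMx]; field_simp
      have e3 : x * (x ^ 11 / 2 ^ 18 * (x - x ^ 11 / 2 ^ 18) / 6)
          ≤ x * (x ^ 11 / 2 ^ 18 * (gaussianPDFReal 0 1 t - x ^ 11 / 2 ^ 18) / 6) := by gcongr
      have e4 : x * (x ^ 11 / 2 ^ 18 * (x - x ^ 11 / 2 ^ 18) / 6)
          = x ^ 13 / (6 * 2 ^ 18) - x ^ 23 / (6 * 2 ^ 36) := by ring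
      have h23 := hpow 23 13 (by norm_num)
      have h21 := hpow 21 13 (by norm_num)
      have : 0 < x ^ 13 := by positivity
      rw [e1, e2]
      rw [e4] at e3
      linarith)
    (by
      have e : 2 * M * (x ^ 4 / 16) = x ^ 3 / 8 := by rw [hMx]; field_simp; norm_num
      rw [e]; linarith)
    (by
      have e : M * (x ^ 25 / 2 ^ 43) = x ^ 24 / 2 ^ 43 := by rw [hMx]; field_simp
      have := hpow 24 3 (by norm_num)
      rw [e]; linarith)
    (by positivity) hδ (by positivity)
    (by
      have : (N.card : ℝ) ≤ (2 * K + 1) ^ n := by exact_mod_cast hNcard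
      linarith)
    (by
      have hlog : Real.log (2 * (2 * (2 * K + 1) ^ n) / δ)
          = ℓ + Real.log 2 + n * Real.log (2 * K + 1) := by
        have e : 2 * (2 * (2 * (K : ℝ) + 1) ^ n) / δ = 2 / δ * 2 * (2 * K + 1) ^ n := by ring
        rw [← Real.log_pow, e, Real.log_mul (by positivity) (by positivity),
          Real.log_mul (by positivity) (by norm_num)]
      have hl2 : Real.log 2 ≤ 1 := by linarith [Real.log_two_lt_d9]
      have hlK : (n : ℝ) * Real.log (2 * K + 1) ≤ M * (2 ^ 46 * M ^ 26) := by
        have h1 := Real.log_le_sub_one_of_pos (show (0 : ℝ) < 2 * K + 1 by positivity)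
        exact mul_le_mul hn (by linarith) (Real.log_nonneg
          (by linarith [Nat.cast_nonneg' (α := ℝ) K])) hM0.le
      have hM27 : 1 ≤ M ^ 27 := one_le_pow₀ hM
      have hbig : ℓ + Real.log 2 + n * Real.log (2 * K + 1) ≤ 2 ^ 49 * M ^ 27 * ℓ := by
        have h2 : M ^ 27 * (1 / 2) ≤ M ^ 27 * ℓ := by gcongr
        have h3 : 1 * ℓ ≤ M ^ 27 * ℓ := by gcongr
        have h4 : M * (2 ^ 46 * M ^ 26) = 2 ^ 46 * M ^ 27 := by ring
        linarith
      rw [hlog]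
      refine hbig.trans ?_
      have e : 2 ^ 49 * M ^ 27 * ℓ
          = (2 ^ 100 * M ^ 55 * ℓ) * (x ^ 13 / 2 ^ 25) ^ 2 / (2 * M ^ 2) := by
        rw [hMx]; field_simp
      rw [e]
      gcongr)
  refine hmain.trans (measureReal_mono ?_)
  rintro ω ⟨σ, hσ⟩
  refine ⟨σ, fun i j => (hσ i j).trans ?_⟩
  have := hpow 4 1 (by norm_num)
  linarith

theorem mainTheorem6 (c : ℝ) (hc : 0 < c) :
    ∃ C : ℝ, 0 < C ∧
      ∀ (d n m : ℕ) (t ε₂ ε₃ δ : ℝ),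
        (n : ℝ) ≤ c * (d : ℝ) ^ c →
        1 / (c * (d : ℝ) ^ c) ≤ gaussianPDFReal 0 1 t →
        0 < ε₂ → ε₂ ≤ 1 → 0 < ε₃ → ε₃ ≤ 1 → 0 < δ → δ < 1 →
        C * ((d : ℝ) / (ε₃ * ε₂)) ^ C * Real.log (2 / δ) ≤ (m : ℝ) →
        ∃ learner : (Fin m → EuclideanSpace ℝ (Fin n) × ℝ) → (Fin d → EuclideanSpace ℝ (Fin n)),
          Measurable learner ∧
          ∀ (w : Fin d → EuclideanSpace ℝ (Fin n)) (P : MvPolynomial (Fin d) ℝ) (μ : ℝ),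
            Orthonormal ℝ w →
            (∀ i, P.degreeOf i ≤ 1) →
            (∀ v : Fin d → ℝ, (∀ i, v i = 0 ∨ v i = 1) →
              |MvPolynomial.eval v P| ≤ c * (d : ℝ) ^ c) →
            (∀ i, μ = ∫ x, hiddenLayer t w x i ∂(stdGaussian (EuclideanSpace ℝ (Fin n)))) →
            (∀ i, ε₃ * μ < MvPolynomial.coeff (Finsupp.single i 1) (shiftScale μ P)) →
            1 - δ ≤ (Measure.pi fun _ : Fin m => stdGaussian (EuclideanSpace ℝ (Fin n))).real
              {ω | EntrywiseClose ε₂ (learner (labelledSample P t w ω)) w} := by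
  refine ⟨2 ^ 100 * (2 + c) ^ 55 + 55 * (c + 1), by positivity, ?_⟩
  intro d n m t ε₂ ε₃ δ hn ht hε₂ hε₂1 hε₃ hε₃1 hδ hδ1 hm
  rcases Nat.eq_zero_or_pos d with rfl | hd
  · -- without hidden units there is nothing to learn
    refine ⟨fun _ => 0, measurable_const, fun w P μ _ _ _ _ _ => ?_⟩
    have huniv : {ω : Fin m → EuclideanSpace ℝ (Fin n) |
        EntrywiseClose ε₂ ((fun _ => 0 : (Fin m → EuclideanSpace ℝ (Fin n) × ℝ) →
          Fin 0 → EuclideanSpace ℝ (Fin n)) (labelledSample P t w ω)) w} = Set.univ :=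
      Set.eq_univ_of_forall fun _ => ⟨Equiv.refl _, fun i => i.elim0⟩
    rw [huniv, probReal_univ]
    linarith
  have hd1 : (1 : ℝ) ≤ d := by exact_mod_cast hd
  set R : ℝ := (d : ℝ) / (ε₃ * ε₂) with hR
  have hprod : ε₃ * ε₂ ≤ 1 := mul_le_one₀ hε₃1 hε₂.le hε₂1
  have hdR : (d : ℝ) ≤ R := by
    rw [hR, le_div_iff₀ (by positivity)]; nlinarith
  have hR1 : 1 ≤ R := hd1.trans hdR
  have hε₂R : 1 / R ≤ ε₂ := by
    rw [hR, one_div_div, div_le_iff₀ (by positivity)]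
    nlinarith
  have hε₃R : 1 / R ≤ ε₃ := by
    rw [hR, one_div_div, div_le_iff₀ (by positivity)]
    nlinarith
  -- one number bounding all problem parameters
  set M : ℝ := (2 + c) * R ^ (c + 1) with hMdef
  have hRc : R ≤ R ^ (c + 1) := Real.self_le_rpow_of_one_le hR1 (by linarith)
  have hRM : R ≤ M := by nlinarith
  have hM : 1 ≤ M := hR1.trans hRM
  have hcd : c * (d : ℝ) ^ c ≤ M := by
    have h1 : (d : ℝ) ^ c ≤ R ^ (c + 1) :=
      (Real.rpow_le_rpow (by positivity) hdR hc.le).trans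
        (Real.rpow_le_rpow_of_exponent_le hR1 (by linarith))
    have h2 : 0 ≤ (d : ℝ) ^ c := by positivity
    nlinarith
  have hinv : ∀ {a b : ℝ}, 0 < a → a ≤ b → 1 / b ≤ 1 / a := fun ha hab =>
    one_div_le_one_div_of_le ha hab
  have hm' : 2 ^ 100 * M ^ 55 * Real.log (2 / δ) ≤ m := by
    refine le_trans (mul_le_mul_of_nonneg_right ?_ (Real.log_nonneg ?_)) hm
    · have h1 : M ^ 55 = (2 + c) ^ 55 * R ^ (55 * (c + 1)) := by
        rw [hMdef, mul_pow, ← Real.rpow_natCast (R ^ (c + 1)), ← Real.rpow_mul (by positivity),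
          mul_comm (c + 1)]
        norm_num
      rw [h1, ← mul_assoc]
      have h2 : (0 : ℝ) ≤ 2 ^ 100 * (2 + c) ^ 55 := by positivity
      exact mul_le_mul (by linarith)
        (Real.rpow_le_rpow_of_exponent_le hR1 (by linarith)) (by positivity) (by positivity)
    · rw [le_div_iff₀ hδ]; linarith
  obtain ⟨learner, hmeas, hlearner⟩ := exists_learner_of_bounds (t := t) (ε := ε₂) hM
    (hn.trans hcd) (hdR.trans hRM) ((hinv (by positivity) hcd).trans ht)
    ((hinv (by positivity) hRM).trans hε₂R) hδ hδ1 hm'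
  refine ⟨learner, hmeas, fun w P μ hw hdeg hP hμ hcoeff => ?_⟩
  refine hlearner w P hw (fun v hv => (hP v hv).trans hcd) fun j => ?_
  exact ((hinv (by positivity) hRM).trans hε₃R).trans
    (lt_integral_jump hdeg hw (hμ j) (hcoeff j)).le
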